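/- We consider deterministic algorithms in the synchronous message-passing model: the network is a finite simple graph $G=(V,E)$ with $n$ nodes; in every round each node can send a possibly different bit string to each neighbor, receives the messages sent to it in this round, and performs arbitrary internal computation. The nodes have unique identifiers in $\{0,\dots,n^c\}$ for a constant $c$ (that is, of $O(\log n)$ bits). Initially each node $v$ knows its own identifier, the identifiers of its neighbors, the directions of its incident edges, its own list $L_v$, and the global parameters $n$, the maximum degree $\Delta$ of $G$, $C$, $r$ and $\varepsilon$. Theorem. For every $c$ there are constants $K_1,K_2$ such that the following holds for all integers $n,\Delta,C\ge 0$ and $r\ge 1$ and every real $\varepsilon\in(0,1]$. There is a deterministic distributed algorithm that runs for at most $K_1\cdot\frac{r\cdot C^{2/r}}{\varepsilon^3}\cdot\log_2 n$ rounds and has the following properties on every $n$-node graph $G=(V,E)$ of maximum degree $\Delta$ with identifiers as above, for every orientation of all edges of $G$, with $\beta(v)$ denoting the out-degree of $v$, and for all lists $L_v$ ($v\in V$) of colors from a color space of size $C$ (with $\log_2 0$ read as $0$ in the bounds, in the degenerate cases $n=0$ and $C=0$): 1. every message consists of at most $K_2\cdot(\log_2 n+\log_2 C)$ bits; 2. the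 output is a proper partial list coloring: each node $v$ outputs a value $x_v\in L_v\cup\{\bot\}$, and for any two neighbors $u,v$ either $x_u\ne x_v$ or $x_u=x_v=\bot$; 3. every node $v$ with $|L_v|>(2+\varepsilon)^r\,\beta(v)$ receives a color, i.e., $x_v\neq\bot$. -/

import Mathlib

/-- An orientation of all edges of the graph `G`: every edge `{u, v}` is directed in exactly one of
the two ways; `arc u v` means that it is directed from `u` to `v`. -/
structure EdgeOrientation {V : Type*} (G : SimpleGraph V) where
  arc : V → V → Prop
  adj_iff : ∀ u v, G.Adj u v ↔ arc u v ∨ arc v u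
  asymm : ∀ u v, arc u v → ¬ arc v u

namespace EdgeOrientation

variable {V : Type*} [Fintype V] {G : SimpleGraph V}

open Classical in
/-- The out-neighbors of `v`. -/
noncomputable def outNeighbors (O : EdgeOrientation G) (v : V) : Finset V :=
  Finset.univ.filter fun u => O.arc v u

open Classical in
/-- The in-neighbors of `v`. -/
noncomputable def inNeighbors (O : EdgeOrientation G) (v : V) : Finset V :=
  Finset.univ.filter fun u => O.arc u v

/-- The out-degree `β(v)` of `v`. -/
noncomputable def outDegree (O : EdgeOrientation G) (v : V) : ℕ :=
  (O.outNeighbors v).card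

end EdgeOrientation

/-- A deterministic algorithm for the synchronous message passing model. All nodes run the same
algorithm, and internal computations are unrestricted. A node starts in a state that is determined
by its own input. In each round it sends to each neighbor a message, a bit string that depends on
its state and on the identifier of that neighbor (different neighbors may get different messages,
and the empty bit string may serve as "no message"); it then receives the messages sent to it in
this round, each together with the identifier of its sender, and updates its state. -/
structure DistributedAlgorithm (Input Output : Type) where
  State : Type
  init : Input → State
  send : State → ℕ → List Bool
  receive : State → Finset (ℕ × List Bool) → State
  output : State → Output

namespace DistributedAlgorithm

variable {Input Output : Type} {V : Type*} [Fintype V]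

/-- The states of all nodes after `t` rounds, when the algorithm runs on the network `G` whose node
`v` has the identifier `ident v` and the input `input v`. -/
def stateAfter (A : DistributedAlgorithm Input Output) (G : SimpleGraph V) [DecidableRel G.Adj]
    (ident : V → ℕ) (input : V → Input) : ℕ → V → A.State
  | 0, v => A.init (input v)
  | t + 1, v =>
      A.receive (A.stateAfter G ident input t v)
        ((G.neighborFinset v).image fun u =>
          (ident u, A.send (A.stateAfter G ident input t u) (ident v)))

/-- The message sent from `u` to its neighbor `v` in round `t + 1`. -/
def message (A : DistributedAlgorithm Input Output) (G : SimpleGraph V) [DecidableRel G.Adj]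
    (ident : V → ℕ) (input : V → Input) (t : ℕ) (u v : V) : List Bool :=
  A.send (A.stateAfter G ident input t u) (ident v)

/-- The output of the node `v` when the algorithm stops after `T` rounds. -/
def outputAfter (A : DistributedAlgorithm Input Output) (G : SimpleGraph V) [DecidableRel G.Adj]
    (ident : V → ℕ) (input : V → Input) (T : ℕ) (v : V) : Output :=
  A.output (A.stateAfter G ident input T v)

end DistributedAlgorithm

/-- What a node of an edge-oriented graph knows initially about a list coloring instance with the
color space `Fin C`: its identifier, the identifiers of its neighbors with the directions of the
edges to them, and its own color list. -/
structure ListColoringInput (C : ℕ) where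
  ident : ℕ
  outIdents : Finset ℕ
  inIdents : Finset ℕ
  colors : Finset (Fin C)

/-- The initial knowledge of the node `v`. -/
noncomputable def listColoringInput {V : Type*} [Fintype V] {G : SimpleGraph V} {C : ℕ}
    (O : EdgeOrientation G) (ident : V → ℕ) (L : V → Finset (Fin C)) (v : V) :
    ListColoringInput C where
  ident := ident v
  outIdents := (O.outNeighbors v).image ident
  inIdents := (O.inNeighbors v).image ident
  colors := L v

/-- A proper partial list coloring: every node has a color of its own list or no color (`none`),
and two neighbors never have the same color. -/
def IsProperPartialListColoring {V : Type*} {Color : Type*} (G : SimpleGraph V)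
    (L : V → Finset Color) (x : V → Option Color) : Prop :=
  (∀ v, ∀ a, x v = some a → a ∈ L v) ∧
    ∀ u v, G.Adj u v → x u ≠ x v ∨ (x u = none ∧ x v = none)

-- The color space is cut down digit by digit. Take `p` about C^(1/r), so that colors have r digits
-- in base `p`. In each of r levels every node fixes one more digit of its color, keeps only the
-- colors with that digit, and drops the neighbors that chose another digit. The invariant after l
-- levels is |L_v| > (2+ε)^(r-l) β_l(v) for the nodes that must be colored, where β_l counts
-- out-neighbors in a freshly chosen direction of the surviving edges (`LevelInvariant`). After r
-- levels a list has at most one color, so such a node has no out-neighbor left; since every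
-- surviving edge is an out-edge of one of its ends, no conflict remains. Nodes with too short a
-- list never take part and stay uncolored.
--
-- One level costs a factor 2+ε (`lt_card_next_colors`). Repeatedly peel off the nodes with at most
-- (2+ε/2)β present neighbors. Every edge is an out-edge of some end, so by double counting the
-- total out-degree of the present nodes falls by a factor 1+ε/4 per round, and O(log N / ε) layers
-- suffice (`not_unpeeled_of_lt`). Each node then has at most (2+ε/2)β neighbors in its own or later
-- layers (`card_filter_peelLayer_le`). The layers choose digits in reverse order; inside a layer
-- the nodes are scheduled by a defective coloring with O(p²/ε²) colors, obtained by Linial's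
-- polynomial recoloring (`card_recolor_eq_le`). Neighbors choosing simultaneously are so few that
-- charging all of them to each of the `p` digits costs only (ε/2)β, and pigeonhole yields a good
-- digit (`chooseClass_spec`). The new out-neighbors are those with the same digit that chose no
-- later.
--
-- The number of rounds is dominated by r levels times O(log n / ε) layers times O(p²/ε²) color
-- classes. All labellings are defined globally on networks whose nodes are the identifiers; their
-- local computability is a separate argument (`LocallyComputable.iterate`), in which each message
-- is one flag, one defective color or one optional digit.

universe u

/-! ### Networks on the set of identifiers -/

/-- A list coloring instance whose nodes are the identifiers below `N`. -/
structure Network (N C : ℕ) where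
  arc : Fin N → Fin N → Prop
  asymm : ∀ i j, arc i j → ¬ arc j i
  colors : Fin N → Finset (Fin C)

namespace Network

variable {N C : ℕ}

/-- Adjacency in the underlying undirected graph. -/
def Adj (I : Network N C) (i j : Fin N) : Prop := I.arc i j ∨ I.arc j i

theorem Adj.symm {I : Network N C} {i j : Fin N} (h : I.Adj i j) : I.Adj j i := Or.symm h

open Classical in
/-- What node `v` knows at the beginning: its name, its out- and in-neighbors, and its list. -/
noncomputable def localInput (I : Network N C) (v : Fin N) :
    Fin N × Finset (Fin N) × Finset (Fin N) × Finset (Fin C) :=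
  (v, Finset.univ.filter fun j => I.arc v j, Finset.univ.filter fun j => I.arc j v, I.colors v)

open Classical in
/-- The restriction of a labelling `y` to the closed neighborhood of `v`. -/
noncomputable def view {μ : Type} [Inhabited μ] (I : Network N C) (y : Fin N → μ) (v : Fin N) :
    Fin N → μ :=
  fun j => if j = v ∨ I.Adj v j then y j else default

theorem view_self {μ : Type} [Inhabited μ] (I : Network N C) (y : Fin N → μ) (v : Fin N) :
    I.view y v v = y v := by simp [view]

theorem view_adj {μ : Type} [Inhabited μ] (I : Network N C) (y : Fin N → μ) {v j : Fin N}
    (h : I.Adj v j) : I.view y v j = y j := by simp [view, h]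

open Classical in
/-- The network on the identifiers of an oriented graph; unused identifiers become isolated nodes
with an empty list. -/
noncomputable def ofGraph {V : Type*} {G : SimpleGraph V} (O : EdgeOrientation G) (ident : V → ℕ)
    (hinj : Function.Injective ident) (L : V → Finset (Fin C)) : Network N C where
  arc i j := ∃ u v, ident u = i ∧ ident v = j ∧ O.arc u v
  asymm := by
    rintro i j ⟨u, v, hu, hv, h⟩ ⟨v', u', hv', hu', h'⟩
    obtain rfl : v = v' := hinj (hv.trans hv'.symm)
    obtain rfl : u = u' := hinj (hu.trans hu'.symm)
    exact O.asymm _ _ h h'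
  colors i := if h : ∃ v, ident v = i then L h.choose else ∅

section ofGraph

variable {V : Type*} {G : SimpleGraph V} (O : EdgeOrientation G) {ident : V → ℕ}
  (hinj : Function.Injective ident) (hlt : ∀ v, ident v < N) (L : V → Finset (Fin C))

theorem ofGraph_arc (u v : V) :
    (ofGraph (N := N) O ident hinj L).arc ⟨ident u, hlt u⟩ ⟨ident v, hlt v⟩ ↔ O.arc u v := by
  constructor
  · rintro ⟨u', v', hu, hv, h⟩
    obtain rfl := hinj hu
    obtain rfl := hinj hv
    exact h
  · exact fun h => ⟨u, v, rfl, rfl, h⟩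

theorem ofGraph_adj (u v : V) :
    (ofGraph (N := N) O ident hinj L).Adj ⟨ident u, hlt u⟩ ⟨ident v, hlt v⟩ ↔ G.Adj u v := by
  rw [Adj, ofGraph_arc, ofGraph_arc, O.adj_iff]

theorem ofGraph_colors (v : V) :
    (ofGraph (N := N) O ident hinj L).colors ⟨ident v, hlt v⟩ = L v := by
  have h : ∃ u, ident u = ident v := ⟨v, rfl⟩
  have : (ofGraph (N := N) O ident hinj L).colors ⟨ident v, hlt v⟩ = L h.choose := by
    simp only [ofGraph]; rw [dif_pos h]
  rw [this, hinj h.choose_spec]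

end ofGraph

end Network

open Network

/-! ### Local computability and broadcasting -/

/-- The labelling `f` of all networks is computed in `T` rounds by a deterministic distributed
algorithm with messages of at most `b` bits. -/
def LocallyComputable {N C : ℕ} (b T : ℕ) {α : Type} (f : Network N C → Fin N → α) : Prop :=
  ∃ A : DistributedAlgorithm (ListColoringInput C) α,
    ∀ (V : Type u) [Fintype V] (G : SimpleGraph V) [DecidableRel G.Adj]
      (O : EdgeOrientation G) (ident : V → ℕ) (hinj : Function.Injective ident)
      (hlt : ∀ v, ident v < N) (L : V → Finset (Fin C)),
      (∀ t < T, ∀ u v,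
        (A.message G ident (listColoringInput O ident L) t u v).length ≤ b) ∧
      ∀ v, A.outputAfter G ident (listColoringInput O ident L) T v =
        f (ofGraph O ident hinj L) ⟨ident v, hlt v⟩

namespace LocallyComputable

variable {N C b T : ℕ} {α : Type}

open Classical in
theorem localInput [NeZero N] : LocallyComputable.{u} (N := N) (C := C) b 0 Network.localInput := by
  refine ⟨⟨Fin N × Finset (Fin N) × Finset (Fin N) × Finset (Fin C),
    fun i => (Fin.ofNat N i.ident, Finset.univ.filter fun j => j.val ∈ i.outIdents,
      Finset.univ.filter fun j => j.val ∈ i.inIdents, i.colors), fun _ _ => [],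
    fun s _ => s, id⟩, ?_⟩
  intro V _ G _ O ident hinj hlt L
  refine ⟨fun t ht => absurd ht (Nat.not_lt_zero t), fun v => ?_⟩
  simp only [DistributedAlgorithm.outputAfter, DistributedAlgorithm.stateAfter, id,
    Network.localInput, listColoringInput]
  refine Prod.ext ?_ (Prod.ext ?_ (Prod.ext ?_ ?_))
  · exact Fin.ext (Nat.mod_eq_of_lt (hlt v))
  · ext j
    simp only [EdgeOrientation.outNeighbors, Finset.mem_image, Finset.mem_filter,
      Finset.mem_univ, true_and]
    constructor
    · rintro ⟨u, hu, huj⟩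
      exact ⟨v, u, rfl, huj, hu⟩
    · rintro ⟨v', u, hv, huj, h⟩
      obtain rfl := hinj hv
      exact ⟨u, h, huj⟩
  · ext j
    simp only [EdgeOrientation.inNeighbors, Finset.mem_image, Finset.mem_filter,
      Finset.mem_univ, true_and]
    constructor
    · rintro ⟨u, hu, huj⟩
      exact ⟨u, v, huj, rfl, hu⟩
    · rintro ⟨u, v', huj, hv, h⟩
      obtain rfl := hinj hv
      exact ⟨u, h, huj⟩
  · exact (ofGraph_colors O hinj hlt L v).symm

theorem map {β : Type} {f : Network N C → Fin N → α} (hf : LocallyComputable.{u} b T f)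
    (g : α → β) : LocallyComputable.{u} b T (fun I v => g (f I v)) := by
  obtain ⟨A, hA⟩ := hf
  refine ⟨⟨A.State, A.init, A.send, A.receive, fun s => g (A.output s)⟩, ?_⟩
  intro V _ G _ O ident hinj hlt L
  obtain ⟨h1, h2⟩ := hA V G O ident hinj hlt L
  have key : ∀ t, DistributedAlgorithm.stateAfter
      ⟨A.State, A.init, A.send, A.receive, fun s => g (A.output s)⟩ G ident
      (listColoringInput O ident L) t = A.stateAfter G ident (listColoringInput O ident L) t := by
    intro t
    induction t with
    | zero => rfl
    | succ t ih => funext v; simp only [DistributedAlgorithm.stateAfter, ih]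
  refine ⟨fun t ht u v => ?_, fun v => ?_⟩
  · simp only [DistributedAlgorithm.message, key]
    exact h1 t ht u v
  · simp only [DistributedAlgorithm.outputAfter, key]
    exact congrArg g (h2 v)

theorem of_eq_map {β : Type} {f : Network N C → Fin N → α} (hf : LocallyComputable.{u} b T f)
    (g : α → β) {h : Network N C → Fin N → β} (hg : ∀ I v, h I v = g (f I v)) :
    LocallyComputable.{u} b T h := by
  have : h = fun I v => g (f I v) := by funext I v; exact hg I v
  rw [this]
  exact hf.map g

open Classical in
/-- One round in which every node broadcasts a value of a type with at most `2 ^ b` elements. -/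
theorem exchange {μ : Type} [Fintype μ] [Inhabited μ] (hμ : Fintype.card μ ≤ 2 ^ b)
    {f : Network N C → Fin N → α} (hf : LocallyComputable.{u} b T f) (h : α → μ) :
    LocallyComputable.{u} b (T + 1) (fun I v => (f I v, I.view (fun j => h (f I j)) v)) := by
  obtain ⟨A, hA⟩ := hf
  obtain ⟨e⟩ : Nonempty (μ ↪ (Fin b → Bool)) :=
    Function.Embedding.nonempty_of_card_le (by simpa using hμ)
  let enc : μ → List Bool := fun x => List.ofFn (e x)
  have hencinj : Function.Injective enc := fun x y hxy => e.injective (List.ofFn_injective hxy)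
  -- The state holds a clock, a state of `A`, the own identifier and the received labels. The clock
  -- tells when the simulation of `A` ends and the broadcast takes place.
  let A' : DistributedAlgorithm (ListColoringInput C) (α × (Fin N → μ)) :=
    { State := ℕ × A.State × ℕ × (Fin N → μ)
      init := fun i => (0, A.init i, i.ident, fun _ => default)
      send := fun s i => if s.1 < T then A.send s.2.1 i else enc (h (A.output s.2.1))
      receive := fun s R =>
        (s.1 + 1, if s.1 < T then A.receive s.2.1 R else s.2.1, s.2.2.1,
          fun j => if j = s.2.2.1 then h (A.output s.2.1) else
            if hj : ∃ x, (j.val, enc x) ∈ R then hj.choose else default)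
      output := fun s => (A.output s.2.1, s.2.2.2) }
  refine ⟨A', ?_⟩
  intro V _ G _ O ident hinj hlt L
  obtain ⟨h1, h2⟩ := hA V G O ident hinj hlt L
  have hclock : ∀ t v, (A'.stateAfter G ident (listColoringInput O ident L) t v).1 = t := by
    intro t
    induction t with
    | zero => intro v; rfl
    | succ t ih =>
      intro v
      simp only [DistributedAlgorithm.stateAfter]
      change (A'.stateAfter G ident (listColoringInput O ident L) t v).1 + 1 = _
      rw [ih]
  have hid : ∀ t v, (A'.stateAfter G ident (listColoringInput O ident L) t v).2.2.1 = ident v := by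
    intro t
    induction t with
    | zero => intro v; rfl
    | succ t ih =>
      intro v
      simp only [DistributedAlgorithm.stateAfter]
      exact ih v
  have hst : ∀ t ≤ T, ∀ v, (A'.stateAfter G ident (listColoringInput O ident L) t v).2.1 =
      A.stateAfter G ident (listColoringInput O ident L) t v := by
    intro t
    induction t with
    | zero => intro _ v; rfl
    | succ t ih =>
      intro ht v
      have ht' : t < T := ht
      simp only [DistributedAlgorithm.stateAfter]
      simp only [A', hclock, if_pos ht']
      congr 1
      · exact ih ht'.le v
      · refine Finset.image_congr fun u _ => ?_
        exact congrArg (fun s => (ident u, A.send s (ident v))) (ih ht'.le u)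
  have hsend : ∀ u v, A'.message G ident (listColoringInput O ident L) T u v =
      enc (h (A.outputAfter G ident (listColoringInput O ident L) T u)) := by
    intro u v
    simp only [DistributedAlgorithm.message, DistributedAlgorithm.outputAfter, A', hclock,
      lt_irrefl, if_false]
    rw [← hst T le_rfl u]
  refine ⟨fun t ht u v => ?_, fun v => ?_⟩
  · rcases Nat.lt_succ_iff_lt_or_eq.1 ht with ht | rfl
    · have := h1 t ht u v
      simp only [DistributedAlgorithm.message] at this ⊢
      simp only [A', hclock, if_pos ht]
      rw [← hst t ht.le u] at this
      exact this
    · rw [hsend]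
      simp [enc]
  · have hout : ∀ w, A.output ((A'.stateAfter G ident (listColoringInput O ident L) T w).2.1) =
        f (ofGraph O ident hinj L) ⟨ident w, hlt w⟩ := by
      intro w
      rw [hst T le_rfl w]
      exact h2 w
    simp only [DistributedAlgorithm.outputAfter, DistributedAlgorithm.stateAfter]
    refine Prod.ext ?_ ?_
    · change A.output (if (A'.stateAfter G ident (listColoringInput O ident L) T v).1 < T then _
        else (A'.stateAfter G ident (listColoringInput O ident L) T v).2.1) = _
      rw [hclock, if_neg (lt_irrefl T)]
      exact hout v
    · funext j
      change (if (j : ℕ) = (A'.stateAfter G ident (listColoringInput O ident L) T v).2.2.1 then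
        h (A.output ((A'.stateAfter G ident (listColoringInput O ident L) T v).2.1)) else _) = _
      rw [hid, hout]
      by_cases hj : j = ⟨ident v, hlt v⟩
      · subst hj
        simp [view_self]
      · have hj' : (j : ℕ) ≠ ident v := fun h => hj (Fin.ext h)
        rw [if_neg hj']
        -- Both identifiers and codes are injective, so a received pair determines the sender and
        -- its label.
        have hmem : ∀ x, ((j.val, enc x) ∈ (G.neighborFinset v).image fun u =>
            (ident u, A'.send (A'.stateAfter G ident (listColoringInput O ident L) T u)
              (ident v))) ↔ ∃ u, G.Adj v u ∧ ident u = j ∧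
                h (f (ofGraph O ident hinj L) ⟨ident u, hlt u⟩) = x := by
          intro x
          simp only [Finset.mem_image, SimpleGraph.mem_neighborFinset, Prod.mk.injEq]
          refine exists_congr fun u => and_congr_right fun _ => and_congr_right fun _ => ?_
          have := hsend u v
          rw [h2] at this
          simp only [DistributedAlgorithm.message] at this
          rw [this]
          exact hencinj.eq_iff
        by_cases hadj : (ofGraph O ident hinj L).Adj ⟨ident v, hlt v⟩ j
        · obtain ⟨u, rfl⟩ : ∃ u, j = ⟨ident u, hlt u⟩ := by
            rcases hadj with ⟨a, b, _, hb, _⟩ | ⟨a, b, ha, _, _⟩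
            · exact ⟨b, Fin.ext hb.symm⟩
            · exact ⟨a, Fin.ext ha.symm⟩
          refine Eq.trans ?_ (view_adj (ofGraph O ident hinj L)
            (fun j => h (f (ofGraph O ident hinj L) j)) hadj).symm
          have huv := (ofGraph_adj O hinj hlt L v u).1 hadj
          split_ifs with hex
          · obtain ⟨u', _, hu', hx⟩ := (hmem _).1 hex.choose_spec
            obtain rfl := hinj hu'
            exact hx.symm
          · exact absurd ⟨_, (hmem _).2 ⟨u, huv, rfl, rfl⟩⟩ hex
        · rw [dif_neg]
          · simp [view, hj, hadj]
          · rintro ⟨x, hx⟩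
            obtain ⟨u, hu, hj2, _⟩ := (hmem x).1 hx
            apply hadj
            have : j = ⟨ident u, hlt u⟩ := Fin.ext hj2.symm
            rw [this]
            exact (ofGraph_adj O hinj hlt L v u).2 hu

/-- `k` rounds in which the nodes broadcast the values of a recursively defined labelling `x`;
afterwards every node knows the history of its closed neighborhood. -/
theorem iterate {μ : Type} [Fintype μ] [Inhabited μ] (hμ : Fintype.card μ ≤ 2 ^ b)
    {f : Network N C → Fin N → α} (hf : LocallyComputable.{u} b T f)
    (x : Network N C → ℕ → Fin N → μ) (g₀ : α → μ) (g : ℕ → α → (Fin N → μ) → μ)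
    (h₀ : ∀ I v, x I 0 v = g₀ (f I v))
    (h : ∀ I s v, x I (s + 1) v = g s (f I v) (I.view (x I s) v)) (k : ℕ) :
    LocallyComputable.{u} b (T + k)
      (fun I v => (f I v, fun s => if s < k then I.view (x I s) v else default)) := by
  induction k with
  | zero => exact hf.of_eq_map (fun a => (a, fun _ => default)) (by intros; simp)
  | succ k ih =>
    -- The value broadcast in the new round is computed from the view received in the preceding one,
    -- or from the start data if there is none.
    let G : α × (ℕ → Fin N → μ) → μ := fun a =>
      match k with
      | 0 => g₀ a.1
      | k + 1 => g k a.1 (a.2 k)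
    have hG : ∀ I v, G (f I v, fun s => if s < k then I.view (x I s) v else default) = x I k v := by
      intro I v
      cases k with
      | zero => exact (h₀ I v).symm
      | succ k => simp [G, h]
    refine (ih.exchange hμ G).of_eq_map
      (fun a => (a.1.1, fun s => if s = k then a.2 else a.1.2 s)) ?_
    intro I v
    refine Prod.ext rfl ?_
    funext s
    simp only [hG]
    by_cases hs : s = k
    · subst hs; simp
    · have : s < k + 1 ↔ s < k := by omega
      simp [hs, this]

end LocallyComputable

/-! ### Peeling a graph into layers -/

section Peeling

variable {V : Type} (A O : V → Finset V) (θ : ℝ)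

open Classical in
/-- The nodes that are still present after `t` rounds of peeling: a node is peeled off when at most
`θ * |O v|` of its neighbors are present. -/
def unpeeled : ℕ → V → Prop
  | 0, _ => True
  | t + 1, v => unpeeled t v ∧ θ * (O v).card < (((A v).filter fun j => unpeeled t j).card : ℝ)

theorem unpeeled_anti {s t : ℕ} (h : s ≤ t) {v : V} (hv : unpeeled A O θ t v) :
    unpeeled A O θ s v := by
  induction t, h using Nat.le_induction with
  | base => exact hv
  | succ t _ ih => exact ih hv.1

open Classical in
-- A handshake count: each edge inside `U` is seen from both ends and is an out-edge of at least one
-- of them. This is the source of the 2 in 2+ε.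
theorem sum_card_filter_le_two_mul_sum (hcov : ∀ v, ∀ j ∈ A v, j ∈ O v ∨ v ∈ O j) (U : Finset V) :
    ∑ v ∈ U, ((A v).filter (· ∈ U)).card ≤ 2 * ∑ v ∈ U, (O v).card := by
  have h1 : ∀ v ∈ U, ((A v).filter (· ∈ U)).card ≤
      (O v).card + (U.filter fun j => v ∈ O j).card := by
    intro v _
    refine (Finset.card_le_card ?_).trans (Finset.card_union_le _ _)
    intro j hj
    rw [Finset.mem_filter] at hj
    rw [Finset.mem_union, Finset.mem_filter]
    exact (hcov v j hj.1).imp id fun h => ⟨hj.2, h⟩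
  have h2 : ∑ v ∈ U, (U.filter fun j => v ∈ O j).card ≤ ∑ j ∈ U, (O j).card := by
    simp only [Finset.card_filter]
    rw [Finset.sum_comm]
    refine Finset.sum_le_sum fun j _ => ?_
    rw [← Finset.card_filter]
    exact Finset.card_le_card fun v hv => (Finset.mem_filter.1 hv).2
  calc _ ≤ _ := Finset.sum_le_sum h1
    _ ≤ _ := by rw [Finset.sum_add_distrib]; omega

open Classical in
/-- The round in which `v` is peeled off. -/
noncomputable def peelLayer (k : ℕ) (v : V) : ℕ := Nat.count (fun t => unpeeled A O θ t v) k

/-- Presence is decreasing in time, so counting the times of presence finds the first time of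
absence. -/
theorem lt_peelLayer_iff {k m : ℕ} (hm : m < k) (v : V) :
    m < peelLayer A O θ k v ↔ unpeeled A O θ m v := by
  classical
  unfold peelLayer
  constructor
  · intro h
    by_contra hn
    have : Nat.count (fun t => unpeeled A O θ t v) k = Nat.count (fun t => unpeeled A O θ t v) m := by
      obtain ⟨d, rfl⟩ := Nat.exists_eq_add_of_lt hm
      rw [add_assoc, Nat.count_add]
      simp only [Nat.add_eq_left]
      rw [Nat.count_eq_card_filter_range, Finset.card_eq_zero, Finset.filter_eq_empty_iff]
      exact fun x _ hx => hn (unpeeled_anti A O θ (Nat.le_add_right m x) hx)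
    have hle : Nat.count (fun t => unpeeled A O θ t v) m ≤ m := Nat.count_le _
    convert (this ▸ h).not_ge hle
  · intro h
    have h1 : Nat.count (fun t => unpeeled A O θ t v) (m + 1) = m + 1 := by
      rw [Nat.count_eq_card_filter_range, Finset.filter_true_of_mem, Finset.card_range]
      exact fun x hx => unpeeled_anti A O θ (Nat.lt_succ_iff.1 (Finset.mem_range.1 hx)) h
    have h2 := Nat.count_monotone (fun t => unpeeled A O θ t v) (show m + 1 ≤ k from hm)
    rw [h1] at h2
    exact lt_of_lt_of_le (Nat.lt_succ_self m) (by convert h2)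

variable [Fintype V]

open Classical in
-- Every survivor of a round has more than `θ * |O v|` present neighbors, and the handshake count
-- bounds the total number of these.
theorem theta_mul_sum_unpeeled_succ_le (hcov : ∀ v, ∀ j ∈ A v, j ∈ O v ∨ v ∈ O j) (t : ℕ) :
    θ * ∑ v with unpeeled A O θ (t + 1) v, ((O v).card : ℝ) ≤
      2 * ∑ v with unpeeled A O θ t v, ((O v).card : ℝ) := by
  have h := sum_card_filter_le_two_mul_sum A O hcov (Finset.univ.filter (unpeeled A O θ t))
  have h' : ((∑ v with unpeeled A O θ t v,
      ((A v).filter (fun j => unpeeled A O θ t j)).card : ℕ) : ℝ) ≤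
      2 * ∑ v with unpeeled A O θ t v, ((O v).card : ℝ) := by
    simp only [Finset.mem_filter, Finset.mem_univ, true_and] at h
    exact_mod_cast h
  refine le_trans ?_ h'
  push_cast
  rw [Finset.mul_sum]
  calc _ ≤ ∑ v with unpeeled A O θ (t + 1) v,
        (((A v).filter (fun j => unpeeled A O θ t j)).card : ℝ) :=
        Finset.sum_le_sum fun v hv => (Finset.mem_filter.1 hv).2.2.le
    _ ≤ _ := by
        refine Finset.sum_le_sum_of_subset_of_nonneg ?_ fun _ _ _ => Nat.cast_nonneg _
        intro v hv
        simp only [Finset.mem_filter, Finset.mem_univ, true_and] at hv ⊢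
        exact hv.1

open Classical in
-- The total out-degree of the present nodes starts at no more than |V|² and shrinks by θ/2 per
-- round. It is an integer, hence zero once the bound drops below 1.
theorem not_unpeeled_of_lt (hcov : ∀ v, ∀ j ∈ A v, j ∈ O v ∨ v ∈ O j) (hθ : 0 ≤ θ) {t : ℕ}
    (ht : (Fintype.card V : ℝ) ^ 2 < (θ / 2) ^ t) (v : V) : ¬ unpeeled A O θ (t + 1) v := by
  set pot : ℕ → ℝ := fun t => ∑ v with unpeeled A O θ t v, ((O v).card : ℝ) with hpot
  have hstep : ∀ t, (θ / 2) ^ t * pot t ≤ (Fintype.card V : ℝ) ^ 2 := by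
    intro t
    induction t with
    | zero =>
      rw [pow_zero, one_mul]
      calc _ ≤ ∑ v with unpeeled A O θ 0 v, (Fintype.card V : ℝ) :=
            Finset.sum_le_sum fun v _ => by exact_mod_cast Finset.card_le_univ (O v)
        _ = _ := by
          have hall : ∀ v ∈ Finset.univ, unpeeled A O θ 0 v := fun _ _ => trivial
          rw [Finset.filter_true_of_mem hall]
          simp [sq]
    | succ t ih =>
      have := theta_mul_sum_unpeeled_succ_le A O θ hcov t
      refine le_trans ?_ ih
      rw [pow_succ, mul_assoc]
      refine mul_le_mul_of_nonneg_left ?_ (by positivity)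
      change θ / 2 * pot (t + 1) ≤ pot t
      change θ * pot (t + 1) ≤ 2 * pot t at this
      linarith
  have hpot0 : ∑ v with unpeeled A O θ t v, (O v).card = 0 := by
    by_contra hne
    have h1 : (1 : ℝ) ≤ pot t := by
      simp only [hpot]
      exact_mod_cast Nat.one_le_iff_ne_zero.2 hne
    have h2 := hstep t
    have h3 : (θ / 2) ^ t * 1 ≤ (θ / 2) ^ t * pot t :=
      mul_le_mul_of_nonneg_left h1 (by positivity)
    linarith
  -- With zero total out-degree no present node has a present neighbor. Survival needs a strict
  -- inequality, so one more round removes everything.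
  intro hv
  have h := sum_card_filter_le_two_mul_sum A O hcov (Finset.univ.filter (unpeeled A O θ t))
  rw [hpot0] at h
  have h0 := (Finset.sum_eq_zero_iff.1 (Nat.le_zero.1 h)) v (by simpa using hv.1)
  simp only [Finset.mem_filter, Finset.mem_univ, true_and] at h0
  have hlt := hv.2
  rw [h0] at hlt
  have : 0 ≤ θ * ((O v).card : ℝ) := by positivity
  simp at hlt
  linarith

open Classical in
-- When `v` is peeled off, its neighbors in the same or later layers are exactly those still
-- present, and the peeling rule bounds their number.
theorem card_filter_peelLayer_le (hcov : ∀ v, ∀ j ∈ A v, j ∈ O v ∨ v ∈ O j) (hθ : 0 ≤ θ) {k : ℕ}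
    (hk : (Fintype.card V : ℝ) ^ 2 < (θ / 2) ^ k) (v : V) :
    (((A v).filter fun j => peelLayer A O θ (k + 1) v ≤ peelLayer A O θ (k + 1) j).card : ℝ) ≤
      θ * (O v).card := by
  have hpos : 0 < peelLayer A O θ (k + 1) v := (lt_peelLayer_iff A O θ (Nat.succ_pos k) v).2 trivial
  obtain ⟨m, hm⟩ := Nat.exists_eq_add_of_lt hpos
  rw [zero_add] at hm
  have hmk : m < k + 1 := by
    have : peelLayer A O θ (k + 1) v ≤ k + 1 := Nat.count_le _
    omega
  have hun : unpeeled A O θ m v := (lt_peelLayer_iff A O θ hmk v).1 (by omega)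
  have hnot : ¬ unpeeled A O θ (m + 1) v := by
    rcases Nat.lt_or_ge (m + 1) (k + 1) with h | h
    · rw [← lt_peelLayer_iff A O θ h v]; omega
    · have : m = k := by omega
      subst this
      exact not_unpeeled_of_lt A O θ hcov hθ hk v
  have hle : ¬ θ * (O v).card < (((A v).filter fun j => unpeeled A O θ m j).card : ℝ) :=
    fun h => hnot ⟨hun, h⟩
  have heq : ((A v).filter fun j => peelLayer A O θ (k + 1) v ≤ peelLayer A O θ (k + 1) j) =
      (A v).filter fun j => unpeeled A O θ m j := by
    refine Finset.filter_congr fun j _ => ?_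
    rw [hm, ← lt_peelLayer_iff A O θ hmk j, Nat.lt_iff_add_one_le]
  rw [heq]
  exact not_lt.1 hle

end Peeling

/-! ### Defective color reduction with polynomials -/

section Recoloring

/-- Take the polynomials of degree below 4 over the field with `2 ^ m` elements: there are `(2 ^ m)
^ 4` of them, and two distinct ones agree in at most three points. -/
theorem exists_family_agreeing_rarely (m : ℕ) (hm : m ≠ 0) :
    ∃ φ : ℕ → ℕ → ℕ, (∀ a x, φ a x < 2 ^ m) ∧ ∀ a b, a < (2 ^ m) ^ 4 → b < (2 ^ m) ^ 4 → a ≠ b →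
      ((Finset.range (2 ^ m)).filter fun x => φ a x = φ b x).card ≤ 3 := by
  classical
  let F := GaloisField 2 m
  have hF : Nat.card F = 2 ^ m := GaloisField.card 2 m hm
  let : Fintype F := Fintype.ofFinite F
  have hF' : Fintype.card F = 2 ^ m := by rw [← Nat.card_eq_fintype_card, hF]
  let eF : F ≃ Fin (2 ^ m) := Fintype.equivFinOfCardEq hF'
  have hP : Fintype.card (Fin 4 → F) = (2 ^ m) ^ 4 := by
    rw [Fintype.card_fun, hF', Fintype.card_fin]
  let eP : (Fin 4 → F) ≃ Fin ((2 ^ m) ^ 4) := Fintype.equivFinOfCardEq hP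
  let poly : (Fin 4 → F) → Polynomial F := fun a => ((Polynomial.degreeLTEquiv F 4).symm a : _)
  have hpoly_inj : Function.Injective poly := fun a b h =>
    (Polynomial.degreeLTEquiv F 4).symm.injective (Subtype.ext h)
  have hpoly_deg : ∀ a, (poly a).degree < (4 : ℕ) := fun a =>
    Polynomial.mem_degreeLT.1 ((Polynomial.degreeLTEquiv F 4).symm a).2
  have : NeZero ((2 ^ m) ^ 4) := ⟨by positivity⟩
  have : NeZero (2 ^ m) := ⟨by positivity⟩
  let φ : ℕ → ℕ → ℕ := fun a x =>
    eF ((poly (eP.symm (Fin.ofNat _ a))).eval (eF.symm (Fin.ofNat _ x)))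
  refine ⟨φ, fun a x => (eF _).2, fun a b ha hb hab => ?_⟩
  by_contra hcard
  rw [not_le] at hcard
  apply hab
  let s : Finset F := ((Finset.range (2 ^ m)).filter fun x => φ a x = φ b x).image
    fun x => eF.symm (Fin.ofNat _ x)
  have hs : s.card = ((Finset.range (2 ^ m)).filter fun x => φ a x = φ b x).card := by
    refine Finset.card_image_of_injOn ?_
    intro x hx y hy hxy
    have hx' := Finset.mem_range.1 (Finset.mem_filter.1 hx).1
    have hy' := Finset.mem_range.1 (Finset.mem_filter.1 hy).1
    have := congrArg Fin.val (eF.symm.injective hxy)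
    simpa [Fin.ofNat, Nat.mod_eq_of_lt hx', Nat.mod_eq_of_lt hy'] using this
  have hdeg : ∀ c, (poly c).degree < s.card := fun c =>
    (hpoly_deg c).trans_le (by rw [hs]; exact_mod_cast hcard)
  have heq := Polynomial.eq_of_degrees_lt_of_eval_finset_eq s (hdeg _) (hdeg _)
    (f := poly (eP.symm (Fin.ofNat _ a))) (g := poly (eP.symm (Fin.ofNat _ b))) (by
      intro y hy
      obtain ⟨x, hx, rfl⟩ := Finset.mem_image.1 hy
      exact eF.injective (Fin.ext (Finset.mem_filter.1 hx).2))
  have := congrArg Fin.val (eP.symm.injective (hpoly_inj heq))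
  simpa [Fin.ofNat, Nat.mod_eq_of_lt ha, Nat.mod_eq_of_lt hb] using this

open Classical in
/-- A family of functions on `2 ^ m` points indexed by `(2 ^ m) ^ 4` colors, any two of which agree
in at most three points. -/
noncomputable def sparseFamily (m : ℕ) : ℕ → ℕ → ℕ :=
  if hm : m ≠ 0 then (exists_family_agreeing_rarely m hm).choose else 0

theorem sparseFamily_lt (m a x : ℕ) : sparseFamily m a x < 2 ^ m := by
  unfold sparseFamily
  split_ifs with hm
  · exact (exists_family_agreeing_rarely m hm).choose_spec.1 a x
  · simp

theorem card_sparseFamily_eq_le {m a b : ℕ} (hm : m ≠ 0) (ha : a < (2 ^ m) ^ 4)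
    (hb : b < (2 ^ m) ^ 4) (hab : a ≠ b) :
    ((Finset.range (2 ^ m)).filter fun x => sparseFamily m a x = sparseFamily m b x).card ≤ 3 := by
  unfold sparseFamily
  simp only [dif_pos hm]
  exact (exists_family_agreeing_rarely m hm).choose_spec.2 a b ha hb hab

variable {V : Type}

open Classical in
/-- The number of nodes of `S` with a color other than `a` that collide with `a` in the point `x`. -/
noncomputable def collisions (m : ℕ) (S : Finset V) (a : ℕ) (col : V → ℕ) (x : ℕ) : ℕ :=
  (S.filter fun j => col j ≠ a ∧ sparseFamily m (col j) x = sparseFamily m a x).card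

open Classical in
/-- The point with few collisions chosen by a node. -/
noncomputable def recolorPoint (m n : ℕ) (f : ℕ → ℕ) : ℕ :=
  if h : ∃ x < 2 ^ m, 2 ^ m * f x ≤ 3 * n then h.choose else 0

/-- One step of color reduction, from `(2 ^ m) ^ 4` to `(2 ^ m) ^ 2` colors. -/
noncomputable def recolor (m : ℕ) (S : Finset V) (a : ℕ) (col : V → ℕ) : ℕ :=
  recolorPoint m S.card (collisions m S a col) +
    2 ^ m * sparseFamily m a (recolorPoint m S.card (collisions m S a col))

theorem collisions_congr {m : ℕ} {S : Finset V} {a : ℕ} {col col' : V → ℕ}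
    (h : ∀ j ∈ S, col j = col' j) : collisions m S a col = collisions m S a col' := by
  classical
  funext x
  unfold collisions
  congr 1
  refine Finset.filter_congr fun j hj => ?_
  rw [h j hj]

theorem recolor_congr {m : ℕ} {S : Finset V} {a : ℕ} {col col' : V → ℕ}
    (h : ∀ j ∈ S, col j = col' j) : recolor m S a col = recolor m S a col' := by
  unfold recolor
  rw [collisions_congr h]

theorem recolorPoint_lt (m n : ℕ) (f : ℕ → ℕ) : recolorPoint m n f < 2 ^ m := by
  unfold recolorPoint
  split_ifs with h
  · exact h.choose_spec.1
  · positivity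

theorem recolor_lt (m : ℕ) (S : Finset V) (a : ℕ) (col : V → ℕ) :
    recolor m S a col < (2 ^ m) ^ 2 := by
  have h1 := recolorPoint_lt m S.card (collisions m S a col)
  have h2 := sparseFamily_lt m a (recolorPoint m S.card (collisions m S a col))
  unfold recolor
  nlinarith

/-- Averaging: each neighbor of another color collides in at most three of the `2 ^ m` points, so
some point has at most the average number of collisions. -/
theorem collisions_recolorPoint_le {m : ℕ} (hm : m ≠ 0) {S : Finset V} {a : ℕ} {col : V → ℕ}
    (ha : a < (2 ^ m) ^ 4) (hcol : ∀ j ∈ S, col j < (2 ^ m) ^ 4) :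
    2 ^ m * collisions m S a col (recolorPoint m S.card (collisions m S a col)) ≤ 3 * S.card := by
  classical
  have hsum : ∑ x ∈ Finset.range (2 ^ m), collisions m S a col x ≤ 3 * S.card := by
    simp only [collisions, Finset.card_filter]
    rw [Finset.sum_comm]
    calc _ ≤ ∑ _j ∈ S, 3 := by
          refine Finset.sum_le_sum fun j hj => ?_
          by_cases hja : col j = a
          · simp [hja]
          · simp only [ne_eq, hja, not_false_eq_true, true_and]
            rw [← Finset.card_filter]
            exact card_sparseFamily_eq_le hm (hcol j hj) ha hja
      _ = _ := by simp [mul_comm]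
  have hex : ∃ x < 2 ^ m, 2 ^ m * collisions m S a col x ≤ 3 * S.card := by
    by_contra! hcon
    have h1 : ∑ _x ∈ Finset.range (2 ^ m), (3 * S.card) <
        ∑ x ∈ Finset.range (2 ^ m), 2 ^ m * collisions m S a col x :=
      Finset.sum_lt_sum_of_nonempty (by simp) fun x hx => hcon x (Finset.mem_range.1 hx)
    rw [← Finset.mul_sum, Finset.sum_const, Finset.card_range, smul_eq_mul] at h1
    rw [← Finset.mul_sum] at h1
    have h2 := Nat.mul_le_mul_left (2 ^ m) hsum
    linarith
  have : 2 ^ m * collisions m S a col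
      (if h : ∃ x < 2 ^ m, 2 ^ m * collisions m S a col x ≤ 3 * S.card then h.choose else 0) ≤
      3 * S.card := by
    rw [dif_pos hex]
    exact hex.choose_spec.2
  exact this

open Classical in
-- With q = `2 ^ m`, the old defect is at most 6D/q² ≤ 3D/q because q ≥ 2, and new collisions add at
-- most 3D/q. The bound 6D/q thus reproduces itself while q is replaced by its square root, and
-- defects do not accumulate over the steps.
theorem card_recolor_eq_le {m : ℕ} (hm : m ≠ 0) {S : V → Finset V} {col : V → ℕ}
    (hcol : ∀ j, col j < (2 ^ m) ^ 4) (v : V) (D : ℕ)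
    (hD : 2 ^ m * (2 ^ m * ((S v).filter fun j => col j = col v).card) ≤ 6 * D)
    (hS : (S v).card ≤ D) :
    2 ^ m * ((S v).filter fun j =>
      recolor m (S j) (col j) col = recolor m (S v) (col v) col).card ≤ 6 * D := by
  have h1 : ((S v).filter fun j =>
      recolor m (S j) (col j) col = recolor m (S v) (col v) col).card ≤
      ((S v).filter fun j => col j = col v).card + collisions m (S v) (col v) col
        (recolorPoint m (S v).card (collisions m (S v) (col v) col)) := by
    refine (Finset.card_le_card ?_).trans (Finset.card_union_le _ _)
    intro j hj
    rw [Finset.mem_filter] at hj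
    rw [Finset.mem_union, Finset.mem_filter, Finset.mem_filter]
    by_cases hc : col j = col v
    · exact Or.inl ⟨hj.1, hc⟩
    · refine Or.inr ⟨hj.1, hc, ?_⟩
      have h := hj.2
      unfold recolor at h
      have hx := recolorPoint_lt m (S v).card (collisions m (S v) (col v) col)
      have hy := recolorPoint_lt m (S j).card (collisions m (S j) (col j) col)
      -- A new color is a two-digit number in base `2 ^ m`: the low digit is the point, the high
      -- digit the value there. Equal colors therefore mean equal values at the same point.
      have hmod := congrArg (· % 2 ^ m) h
      simp only [Nat.add_mul_mod_self_left, Nat.mod_eq_of_lt hx, Nat.mod_eq_of_lt hy] at hmod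
      rw [hmod] at h
      exact Nat.eq_of_mul_eq_mul_left (by positivity) (Nat.add_left_cancel h)
  have h2 := collisions_recolorPoint_le hm (S := S v) (hcol v) fun j _ => hcol j
  have h3 : 2 ≤ 2 ^ m := by
    calc 2 = 2 ^ 1 := rfl
      _ ≤ 2 ^ m := Nat.pow_le_pow_right (by norm_num) (Nat.one_le_iff_ne_zero.2 hm)
  have h4 : 2 * (2 ^ m * ((S v).filter fun j => col j = col v).card) ≤ 6 * D :=
    (Nat.mul_le_mul_right _ h3).trans hD
  have h5 := Nat.mul_le_mul_left (2 ^ m) h1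
  rw [mul_add] at h5
  omega

end Recoloring

/-! ### Sequential choice of a color class -/

section Sweep

variable {V : Type} {p : ℕ}

open Classical in
/-- The partial choices made before time `s`, when the node `v` chooses at time `τ v`, based on the
numbers of neighbors that have made each of the choices. -/
noncomputable def sweep (A : V → Finset V) (τ : V → ℕ) (ch : V → (Fin p → ℕ) → Fin p) :
    ℕ → V → Option (Fin p)
  | 0, _ => none
  | s + 1, v =>
    if τ v = s then some (ch v fun i => ((A v).filter fun j => sweep A τ ch s j = some i).card)
    else sweep A τ ch s v

open Classical in
/-- The final choice of `v`. -/
noncomputable def sweepChoice (A : V → Finset V) (τ : V → ℕ) (ch : V → (Fin p → ℕ) → Fin p)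
    (v : V) : Fin p :=
  ch v fun i => ((A v).filter fun j => sweep A τ ch (τ v) j = some i).card

variable (A : V → Finset V) (τ : V → ℕ) (ch : V → (Fin p → ℕ) → Fin p)

theorem sweep_eq_none {s : ℕ} {v : V} (h : s ≤ τ v) : sweep A τ ch s v = none := by
  induction s with
  | zero => rfl
  | succ s ih => rw [sweep, if_neg (by omega), ih (by omega)]

theorem sweep_eq_some {s : ℕ} {v : V} (h : τ v < s) :
    sweep A τ ch s v = some (sweepChoice A τ ch v) := by
  induction s with
  | zero => omega
  | succ s ih =>
    rw [sweep]
    split_ifs with hs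
    · subst hs; rfl
    · exact ih (by omega)

theorem sweep_eq_some_iff {s : ℕ} {v : V} {i : Fin p} :
    sweep A τ ch s v = some i ↔ τ v < s ∧ sweepChoice A τ ch v = i := by
  rcases Nat.lt_or_ge (τ v) s with h | h
  · rw [sweep_eq_some A τ ch h, Option.some_inj]; simp [h]
  · rw [sweep_eq_none A τ ch h]; simp [h]

open Classical in
/-- A choice `i` that satisfies `B * (c i + D) < |{x ∈ L | e x = i}|`, if possible. -/
noncomputable def chooseClass [NeZero p] {α : Type} (L : Finset α) (e : α → Fin p) (B : ℝ) (D : ℕ)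
    (c : Fin p → ℕ) : Fin p :=
  if h : ∃ i, B * (c i + D) < ((L.filter fun x => e x = i).card : ℝ) then h.choose else 0

open Classical in
-- Pigeonhole: if every class failed, summing the failures over the `p` classes would contradict the
-- size of the whole list. `D` enters for every class because simultaneous choices are unknown.
theorem chooseClass_spec [NeZero p] {α : Type} {L : Finset α} {e : α → Fin p} {B : ℝ} {D : ℕ}
    {c : Fin p → ℕ} (h : B * (∑ i, (c i : ℝ) + p * D) < L.card) :
    B * (c (chooseClass L e B D c) + D) <
      ((L.filter fun x => e x = chooseClass L e B D c).card : ℝ) := by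
  have hex : ∃ i, B * (c i + D) < ((L.filter fun x => e x = i).card : ℝ) := by
    by_contra! hcon
    have h1 : ∑ i : Fin p, ((L.filter fun x => e x = i).card : ℝ) ≤ ∑ i, B * ((c i : ℝ) + D) :=
      Finset.sum_le_sum fun i _ => hcon i
    rw [← Finset.mul_sum, Finset.sum_add_distrib] at h1
    have h2 : L.card = ∑ i : Fin p, (L.filter fun x => e x = i).card :=
      Finset.card_eq_sum_card_fiberwise fun _ _ => Finset.mem_coe.2 (Finset.mem_univ _)
    rw [h2] at h
    push_cast at h
    simp only [Finset.sum_const, Finset.card_univ, Fintype.card_fin, nsmul_eq_mul] at h1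
    linarith
  have : chooseClass L e B D c = hex.choose := by unfold chooseClass; rw [dif_pos hex]
  rw [this]
  exact hex.choose_spec

end Sweep

/-! ### One level of color space reduction -/

/-- What a node knows at the beginning of a level of the recursion: its name, its neighbors and
out-neighbors in the current graph, and its current list. -/
structure LevelState (N C : ℕ) where
  node : Fin N
  nbrs : Finset (Fin N)
  outs : Finset (Fin N)
  colors : Finset (Fin C)

/-- The parameters of one level of the recursion: every node chooses one of `p` parts of the color
space, where the part of the color `x` is `x / w % p`. -/
structure LevelParams where
  p : ℕ
  w : ℕ
  θ : ℝ
  B : ℝ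
  k : ℕ
  m : ℕ
  J : ℕ

namespace LevelParams

/-- The number of rounds of the level. -/
def rounds (P : LevelParams) : ℕ :=
  (P.k + 1) + (P.J + 1) + ((P.k + 1) * (2 ^ P.m) ^ 2 + 1)

variable {N C : ℕ} (P : LevelParams) (κ : Fin N → LevelState N C)

/-- The layer of a node in the peeling process. -/
noncomputable def layer (v : Fin N) : ℕ :=
  peelLayer (fun v => (κ v).nbrs) (fun v => (κ v).outs) P.θ (P.k + 1) v

/-- The neighbors in the same layer. -/
noncomputable def peers (v : Fin N) : Finset (Fin N) :=
  (κ v).nbrs.filter fun j => P.layer κ j = P.layer κ v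

/-- The defective coloring of the layers after `s` steps of color reduction. -/
noncomputable def stageColor [NeZero N] : ℕ → Fin N → Fin N
  | 0, v => v
  | s + 1, v => Fin.ofNat N (recolor (P.m * 2 ^ (P.J - 1 - s)) (P.peers κ v)
      (stageColor s v) fun j => stageColor s j)

/-- The time at which a node chooses its part of the color space. -/
noncomputable def time [NeZero N] (v : Fin N) : ℕ :=
  (P.k + 1 - P.layer κ v) * (2 ^ P.m) ^ 2 + P.stageColor κ P.J v

/-- The number of neighbors that choose at the same time. -/
noncomputable def conflicts [NeZero N] (v : Fin N) : ℕ :=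
  ((κ v).nbrs.filter fun j => P.time κ j = P.time κ v).card

/-- The part of the color space that contains the color `x`. -/
def part [NeZero P.p] (x : Fin C) : Fin P.p := Fin.ofNat P.p (x / P.w)

/-- The rule by which a node chooses its part of the color space. -/
noncomputable def rule [NeZero N] [NeZero P.p] (v : Fin N) : (Fin P.p → ℕ) → Fin P.p :=
  chooseClass (κ v).colors P.part P.B (P.conflicts κ v)

/-- The part of the color space that is chosen by `v`. -/
noncomputable def choice [NeZero N] [NeZero P.p] (v : Fin N) : Fin P.p :=
  sweepChoice (fun v => (κ v).nbrs) (P.time κ) (P.rule κ) v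

/-- The states at the end of the level. -/
noncomputable def next [NeZero N] [NeZero P.p] (v : Fin N) : LevelState N C where
  node := v
  nbrs := (κ v).nbrs.filter fun j => P.choice κ j = P.choice κ v
  outs := (κ v).nbrs.filter fun j => P.choice κ j = P.choice κ v ∧ P.time κ j ≤ P.time κ v
  colors := (κ v).colors.filter fun x => P.part x = P.choice κ v

section Correctness

variable {P κ}

theorem layer_le (v : Fin N) : P.layer κ v ≤ P.k + 1 := by
  classical
  exact Nat.count_le _

theorem one_le_layer (v : Fin N) : 1 ≤ P.layer κ v :=
  (lt_peelLayer_iff _ _ _ (Nat.succ_pos P.k) v).2 trivial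

variable [NeZero N]

/-- With Q = `2 ^ P.m`, stage `s` has base q = Q^(2^(J-s)), fewer than q² colors and defect at most
6/q times the number of peers. Each step replaces q by its square root, ending at Q. -/
theorem stageColor_invariant (hirr : ∀ v, v ∉ (κ v).nbrs) (hm : P.m ≠ 0)
    (hN : N ≤ (2 ^ P.m) ^ 2 ^ (P.J + 1)) (hJ : P.J = 0 ∨ (2 ^ P.m) ^ 2 ^ P.J < N) (s : ℕ)
    (hs : s ≤ P.J) :
    (∀ v, (P.stageColor κ s v : ℕ) < (2 ^ (P.m * 2 ^ (P.J - s))) ^ 2) ∧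
    ∀ v, 2 ^ (P.m * 2 ^ (P.J - s)) *
      ((P.peers κ v).filter fun j => (P.stageColor κ s j : ℕ) = P.stageColor κ s v).card ≤
        6 * (P.peers κ v).card := by
  induction s with
  | zero =>
    refine ⟨fun v => ?_, fun v => ?_⟩
    · refine v.2.trans_le (hN.trans_eq ?_)
      rw [Nat.sub_zero, ← pow_mul, ← pow_mul, pow_succ, mul_assoc]
    · have : ((P.peers κ v).filter fun j =>
          (P.stageColor κ 0 j : ℕ) = P.stageColor κ 0 v) = ∅ := by
        rw [Finset.filter_eq_empty_iff]
        intro j hj h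
        have hjv : j = v := Fin.ext h
        subst hjv
        exact hirr j (Finset.mem_filter.1 hj).1
      rw [this]
      simp
  | succ s ih =>
    obtain ⟨ih1, ih2⟩ := ih (by omega)
    set m' := P.m * 2 ^ (P.J - 1 - s) with hm'
    have hm'0 : m' ≠ 0 := mul_ne_zero hm (by positivity)
    have hq : 2 ^ (P.m * 2 ^ (P.J - s)) = (2 ^ m') ^ 2 := by
      rw [← pow_mul, hm', mul_assoc, ← pow_succ]
      congr 3
      omega
    have hq' : P.m * 2 ^ (P.J - (s + 1)) = m' := by
      rw [hm']; congr 2; omega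
    rw [hq']
    rw [hq] at ih1 ih2
    -- The new colors lie below Q^(2^J) < `N`, so the reduction modulo `N` in `stageColor` changes
    -- nothing.
    have hlt : ∀ v, recolor m' (P.peers κ v) (P.stageColor κ s v)
        (fun j => (P.stageColor κ s j : ℕ)) < N := by
      intro v
      have hJ' : (2 ^ P.m) ^ 2 ^ P.J < N := hJ.resolve_left (by omega)
      refine (recolor_lt _ _ _ _).trans_le (le_trans ?_ hJ'.le)
      rw [← hq, ← pow_mul]
      exact Nat.pow_le_pow_right (by norm_num)
        (Nat.mul_le_mul_left _ (Nat.pow_le_pow_right (by norm_num) (Nat.sub_le _ _)))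
    have hval : ∀ v, (P.stageColor κ (s + 1) v : ℕ) = recolor m' (P.peers κ v)
        (P.stageColor κ s v) (fun j => (P.stageColor κ s j : ℕ)) := fun v =>
      Nat.mod_eq_of_lt (hlt v)
    simp only [hval]
    refine ⟨fun v => recolor_lt _ _ _ _, fun v => ?_⟩
    refine card_recolor_eq_le hm'0 (S := P.peers κ) (col := fun j => (P.stageColor κ s j : ℕ))
      (fun j => ?_) v _ ?_ le_rfl
    · have := ih1 j
      rwa [← pow_mul] at this
    · have := ih2 v
      rw [sq, mul_assoc] at this
      exact this

variable (hirr : ∀ v, v ∉ (κ v).nbrs) (hm : P.m ≠ 0)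
    (hN : N ≤ (2 ^ P.m) ^ 2 ^ (P.J + 1)) (hJ : P.J = 0 ∨ (2 ^ P.m) ^ 2 ^ P.J < N)

include hirr hm hN hJ

theorem stageColor_lt (v : Fin N) : (P.stageColor κ P.J v : ℕ) < (2 ^ P.m) ^ 2 := by
  have := (stageColor_invariant hirr hm hN hJ P.J le_rfl).1 v
  simpa using this

theorem time_lt (v : Fin N) : P.time κ v < (P.k + 1) * (2 ^ P.m) ^ 2 := by
  have h1 := stageColor_lt hirr hm hN hJ v
  have h2 := one_le_layer (P := P) (κ := κ) v
  have h3 : P.k + 1 - P.layer κ v ≤ P.k := by omega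
  unfold time
  nlinarith

/-- Since the final color is below Q², time is lexicographic: layers in reverse order of peeling,
then colors. -/
theorem layer_le_of_time_le {j v : Fin N} (h : P.time κ j ≤ P.time κ v) :
    P.layer κ v ≤ P.layer κ j := by
  by_contra hcon
  have h1 := stageColor_lt hirr hm hN hJ v
  have h2 := layer_le (P := P) (κ := κ) v
  have h3 : P.k + 1 - P.layer κ v + 1 ≤ P.k + 1 - P.layer κ j := by omega
  have h4 := Nat.mul_le_mul_right ((2 ^ P.m) ^ 2) h3
  unfold time at h
  rw [add_mul, one_mul] at h4
  omega

/-- Choosing at the same time means having both the same layer and the same color, so conflicts are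
bounded by the defect. -/
theorem two_pow_mul_conflicts_le (v : Fin N) :
    2 ^ P.m * P.conflicts κ v ≤ 6 * (P.peers κ v).card := by
  have h := (stageColor_invariant hirr hm hN hJ P.J le_rfl).2 v
  rw [Nat.sub_self, pow_zero, mul_one] at h
  refine le_trans (Nat.mul_le_mul_left _ (Finset.card_le_card ?_)) h
  intro j hj
  rw [Finset.mem_filter] at hj
  have hlay : P.layer κ j = P.layer κ v :=
    le_antisymm (layer_le_of_time_le hirr hm hN hJ hj.2.ge)
      (layer_le_of_time_le hirr hm hN hJ hj.2.le)
  have hcol := hj.2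
  unfold time at hcol
  rw [hlay] at hcol
  exact Finset.mem_filter.2 ⟨Finset.mem_filter.2 ⟨hj.1, hlay⟩, Nat.add_left_cancel hcol⟩

/-- Neighbors that chose earlier number at most (2+ε/2)β, and simultaneous ones, counted `p` times,
at most (ε/2)β. Together they fit into the slack 2+ε, so some part of the list retains the factor
`P.B`. -/
theorem lt_card_next_colors [NeZero P.p] {ε : ℝ} (hε : 0 < ε) (hε1 : ε ≤ 1)
    (hθ : P.θ = 2 + ε / 2) (hcov : ∀ v, ∀ j ∈ (κ v).nbrs, j ∈ (κ v).outs ∨ v ∈ (κ j).outs)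
    (hk : (N : ℝ) ^ 2 < (P.θ / 2) ^ P.k) (hQ : 30 * P.p / ε ≤ 2 ^ P.m) (hB : 0 < P.B)
    {v : Fin N} (hv : P.B * (2 + ε) * (κ v).outs.card < (κ v).colors.card) :
    P.B * (P.next κ v).outs.card < (P.next κ v).colors.card := by
  classical
  set c : Fin P.p → ℕ := fun i => ((κ v).nbrs.filter fun j =>
    sweep (fun v => (κ v).nbrs) (P.time κ) (P.rule κ) (P.time κ v) j = some i).card with hc
  have hlater : (((κ v).nbrs.filter fun j => P.layer κ v ≤ P.layer κ j).card : ℝ) ≤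
      P.θ * (κ v).outs.card := by
    have := card_filter_peelLayer_le (fun v => (κ v).nbrs) (fun v => (κ v).outs) P.θ hcov
      (by rw [hθ]; positivity) (k := P.k) (by simpa using hk) v
    exact this
  have hsumc : (∑ i, (c i : ℝ)) ≤ P.θ * (κ v).outs.card := by
    refine le_trans ?_ hlater
    have hnat : ∑ i, c i ≤ ((κ v).nbrs.filter fun j => P.layer κ v ≤ P.layer κ j).card := by
      rw [hc, ← Finset.card_biUnion]
      · refine Finset.card_le_card fun j hj => ?_
        obtain ⟨i, _, hi⟩ := Finset.mem_biUnion.1 hj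
        rw [Finset.mem_filter, sweep_eq_some_iff] at hi
        exact Finset.mem_filter.2 ⟨hi.1, layer_le_of_time_le hirr hm hN hJ hi.2.1.le⟩
      · intro i _ i' _ hii'
        refine Finset.disjoint_filter.2 fun j _ h h' => hii' ?_
        rw [h] at h'
        exact Option.some_injective _ h'
    exact_mod_cast hnat
  have hpeers : ((P.peers κ v).card : ℝ) ≤ P.θ * (κ v).outs.card := by
    refine le_trans ?_ hlater
    have : (P.peers κ v).card ≤ ((κ v).nbrs.filter fun j => P.layer κ v ≤ P.layer κ j).card :=
      Finset.card_le_card fun j hj => by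
        have := Finset.mem_filter.1 hj
        exact Finset.mem_filter.2 ⟨this.1, this.2.ge⟩
    exact_mod_cast this
  -- The 30 in `hQ` comes from here: the defect bound gives 6θβ ≤ 15β, and 15/30 = 1/2.
  have hconf : (P.p : ℝ) * P.conflicts κ v ≤ ε / 2 * (κ v).outs.card := by
    have h1 : (2 : ℝ) ^ P.m * P.conflicts κ v ≤ 6 * (P.peers κ v).card := by
      exact_mod_cast two_pow_mul_conflicts_le hirr hm hN hJ v
    have h2 : 30 * P.p / ε * P.conflicts κ v ≤ 2 ^ P.m * P.conflicts κ v :=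
      mul_le_mul_of_nonneg_right hQ (Nat.cast_nonneg _)
    have h3 : P.θ * (κ v).outs.card ≤ 5 / 2 * (κ v).outs.card :=
      mul_le_mul_of_nonneg_right (by rw [hθ]; linarith) (Nat.cast_nonneg _)
    have h4 : 30 * P.p / ε * P.conflicts κ v ≤ 15 * (κ v).outs.card := by linarith
    have h5 : 30 * P.p / ε * P.conflicts κ v = 30 / ε * (P.p * P.conflicts κ v) := by ring
    rw [h5, div_mul_eq_mul_div, div_le_iff₀ hε] at h4
    linarith
  have hbound : P.B * (∑ i, (c i : ℝ) + P.p * P.conflicts κ v) < (κ v).colors.card := by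
    refine lt_of_le_of_lt ?_ hv
    rw [mul_assoc]
    refine mul_le_mul_of_nonneg_left ?_ hB.le
    rw [hθ] at hsumc
    linarith
  have hspec := chooseClass_spec (e := P.part) hbound
  have hchoice : chooseClass (κ v).colors P.part P.B (P.conflicts κ v) c = P.choice κ v := by
    unfold choice sweepChoice
    rw [hc]
    unfold rule
    congr!
  rw [hchoice] at hspec
  -- A new out-neighbor either chose the same part strictly earlier, and is counted by `c`, or chose
  -- at the same time, and is a conflict.
  have houts : (P.next κ v).outs.card ≤ c (P.choice κ v) + P.conflicts κ v := by
    refine (Finset.card_le_card ?_).trans (Finset.card_union_le _ _)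
    intro j hj
    obtain ⟨hj1, hj2, hj3⟩ := Finset.mem_filter.1 hj
    rw [Finset.mem_union, Finset.mem_filter, Finset.mem_filter]
    rcases hj3.lt_or_eq with h | h
    · exact Or.inl ⟨hj1, (sweep_eq_some_iff _ _ _).2 ⟨h, hj2⟩⟩
    · exact Or.inr ⟨hj1, h⟩
  refine lt_of_le_of_lt (mul_le_mul_of_nonneg_left ?_ hB.le) (lt_of_lt_of_eq hspec ?_)
  · exact_mod_cast houts
  · unfold next
    congr!

end Correctness

end LevelParams

/-! ### Distributed implementation of one level -/

open Classical in
/-- The restriction of a labelling to the node itself and its current neighbors. -/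
noncomputable def LevelState.restrict {N C : ℕ} {μ : Type} [Inhabited μ] (st : LevelState N C)
    (y : Fin N → μ) (j : Fin N) : μ :=
  if j = st.node ∨ j ∈ st.nbrs then y j else default

namespace LevelState

variable {N C : ℕ} {μ : Type} [Inhabited μ] {st : LevelState N C} (y : Fin N → μ)

theorem restrict_node {v : Fin N} (h : st.node = v) : st.restrict y v = y v := by
  simp [restrict, h]

theorem restrict_nbr {j : Fin N} (h : j ∈ st.nbrs) : st.restrict y j = y j := by
  simp [restrict, h]

theorem restrict_view {I : Network N C} {v : Fin N} (h : st.node = v)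
    (hadj : ∀ j ∈ st.nbrs, I.Adj v j) : st.restrict (I.view y v) = st.restrict y := by
  funext j
  unfold restrict Network.view
  split_ifs with h1 h2
  · rfl
  · exact absurd (h1.imp (fun e => e.trans h) (hadj j)) (by assumption)
  · rfl

end LevelState

namespace LocallyComputable

variable {N C b T : ℕ} {β : Type}

/-- Messages travel along all edges of the network, but the rules of a level may read only current
neighbors. These are adjacent nodes, so masking the received view is enough. -/
theorem iterate_restrict {μ : Type} [Fintype μ] [Inhabited μ] (hμ : Fintype.card μ ≤ 2 ^ b)
    {κ : Network N C → Fin N → LevelState N C} {e : Network N C → Fin N → β}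
    (hf : LocallyComputable.{u} b T fun I v => (κ I v, e I v))
    (hnode : ∀ I v, (κ I v).node = v) (hadj : ∀ I v, ∀ j ∈ (κ I v).nbrs, I.Adj v j)
    (x : Network N C → ℕ → Fin N → μ) (g₀ : LevelState N C × β → μ)
    (g : ℕ → LevelState N C × β → (Fin N → μ) → μ)
    (h₀ : ∀ I v, x I 0 v = g₀ (κ I v, e I v))
    (h : ∀ I s v, x I (s + 1) v = g s (κ I v, e I v) ((κ I v).restrict (x I s))) (k : ℕ) :
    LocallyComputable.{u} b (T + k)
      (fun I v => (κ I v, e I v, fun s => if s < k then (κ I v).restrict (x I s) else default)) := by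
  refine (hf.iterate hμ x g₀ (fun s a w => g s a (a.1.restrict w)) h₀ ?_ k).of_eq_map
    (fun a => (a.1.1, a.1.2, fun s => if s < k then a.1.1.restrict (a.2 s) else default)) ?_
  · intro I s v
    rw [h, LevelState.restrict_view _ (hnode I v) (hadj I v)]
  · intro I v
    refine Prod.ext rfl (Prod.ext rfl ?_)
    funext s
    dsimp only
    split_ifs with hs
    · rw [LevelState.restrict_view _ (hnode I v) (hadj I v)]
    · rfl

variable {κ : Network N C → Fin N → LevelState N C}

open Classical in
-- One bit per round, telling whether the node is still present. The layer of a neighbor is the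
-- number of its positive flags.
theorem layer (P : LevelParams) (hb : 2 ≤ 2 ^ b) (hf : LocallyComputable.{u} b T κ)
    (hnode : ∀ I v, (κ I v).node = v) (hadj : ∀ I v, ∀ j ∈ (κ I v).nbrs, I.Adj v j) :
    LocallyComputable.{u} b (T + (P.k + 1))
      (fun I v => (κ I v, (κ I v).restrict (P.layer (κ I)))) := by
  let x : Network N C → ℕ → Fin N → Bool := fun I s v =>
    decide (unpeeled (fun v => (κ I v).nbrs) (fun v => (κ I v).outs) P.θ s v)
  have hf' : LocallyComputable.{u} b T fun I v => (κ I v, ()) := hf.map fun a => (a, ())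
  refine (hf'.iterate_restrict (by simpa using hb) hnode hadj x (fun _ => true)
    (fun s a w => w a.1.node && decide (P.θ * a.1.outs.card <
      ((a.1.nbrs.filter fun j => w j = true).card : ℝ))) ?_ ?_ (P.k + 1)).of_eq_map
    (fun a => (a.1, a.1.restrict fun j => Nat.count (fun s => a.2.2 s j = true) (P.k + 1))) ?_
  · intro I v
    exact decide_eq_true (show unpeeled _ _ _ 0 v from trivial)
  · intro I s v
    have hfil : ((κ I v).nbrs.filter fun j => (κ I v).restrict (x I s) j = true) =
        (κ I v).nbrs.filter fun j =>
          unpeeled (fun v => (κ I v).nbrs) (fun v => (κ I v).outs) P.θ s j :=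
      Finset.filter_congr fun j hj => by
        rw [LevelState.restrict_nbr _ hj]; simp [x]
    dsimp only
    rw [hfil, hnode, LevelState.restrict_node _ (hnode I v), Bool.eq_iff_iff]
    simp only [x, Bool.and_eq_true, decide_eq_true_eq]
    exact Iff.rfl
  · intro I v
    refine Prod.ext rfl ?_
    funext j
    dsimp only
    by_cases hj : j = (κ I v).node ∨ j ∈ (κ I v).nbrs
    · simp only [LevelState.restrict, if_pos hj, LevelParams.layer, peelLayer]
      rw [Nat.count_eq_card_filter_range, Nat.count_eq_card_filter_range]
      congr 1
      refine Finset.filter_congr fun s hs => ?_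
      rw [Finset.mem_range] at hs
      simp only [if_pos hs, x, LevelState.restrict, if_pos hj, decide_eq_true_eq]
    · simp only [LevelState.restrict, if_neg hj]

open Classical in
-- Stage colors are elements of `Fin N`, so each fits in a message. The extra round delivers the
-- final stage `P.J` to the neighbors.
theorem time [NeZero N] (P : LevelParams) (hb : N ≤ 2 ^ b) (hnode : ∀ I v, (κ I v).node = v)
    (hadj : ∀ I v, ∀ j ∈ (κ I v).nbrs, I.Adj v j)
    (hf : LocallyComputable.{u} b T fun I v => (κ I v, (κ I v).restrict (P.layer (κ I)))) :
    LocallyComputable.{u} b (T + (P.J + 1))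
      (fun I v => (κ I v, (κ I v).restrict (P.time (κ I)))) := by
  have : Inhabited (Fin N) := ⟨0⟩
  refine (hf.iterate_restrict (by simpa using hb) hnode hadj (fun I => P.stageColor (κ I))
    (fun a => a.1.node)
    (fun s a w => Fin.ofNat N (recolor (P.m * 2 ^ (P.J - 1 - s))
      (a.1.nbrs.filter fun j => a.2 j = a.2 a.1.node) (w a.1.node) fun j => w j))
    ?_ ?_ (P.J + 1)).of_eq_map
    (fun a => (a.1, a.1.restrict fun j =>
      (P.k + 1 - a.2.1 j) * (2 ^ P.m) ^ 2 + (a.2.2 P.J j : ℕ))) ?_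
  · intro I v
    rw [hnode]; rfl
  · intro I s v
    simp only [hnode, LevelState.restrict_node _ (hnode I v)]
    have hfil : ((κ I v).nbrs.filter fun j =>
        (κ I v).restrict (P.layer (κ I)) j = P.layer (κ I) v) = P.peers (κ I) v :=
      Finset.filter_congr fun j hj => by rw [LevelState.restrict_nbr _ hj]
    rw [hfil]
    change Fin.ofNat N (recolor _ _ _ _) = _
    congr 1
    refine recolor_congr fun j hj => ?_
    rw [LevelState.restrict_nbr _ (Finset.mem_filter.1 hj).1]
  · intro I v
    refine Prod.ext rfl ?_
    funext j
    dsimp only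
    by_cases hj : j = (κ I v).node ∨ j ∈ (κ I v).nbrs
    · simp only [LevelState.restrict, if_pos hj, LevelParams.time, Nat.lt_succ_self, if_true]
    · simp only [LevelState.restrict, if_neg hj]

open Classical in
-- All times lie below `(P.k + 1) * (2 ^ P.m) ^ 2`, so by then every choice is made; one further
-- round lets the neighbors know it.
theorem next [NeZero N] (P : LevelParams) [NeZero P.p] (hb₂ : 2 ≤ 2 ^ b) (hbN : N ≤ 2 ^ b)
    (hbp : P.p + 1 ≤ 2 ^ b) (hf : LocallyComputable.{u} b T κ)
    (hnode : ∀ I v, (κ I v).node = v) (hadj : ∀ I v, ∀ j ∈ (κ I v).nbrs, I.Adj v j)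
    (htime : ∀ I v, P.time (κ I) v < (P.k + 1) * (2 ^ P.m) ^ 2) :
    LocallyComputable.{u} b (T + P.rounds) (fun I v => P.next (κ I) v) := by
  have hf' := time P hbN hnode hadj (layer P hb₂ hf hnode hadj)
  let K := (P.k + 1) * (2 ^ P.m) ^ 2
  let x : Network N C → ℕ → Fin N → Option (Fin P.p) := fun I =>
    sweep (fun v => (κ I v).nbrs) (P.time (κ I)) (P.rule (κ I))
  have hx : ∀ I v, x I K v = some (P.choice (κ I) v) := fun I v =>
    sweep_eq_some _ _ _ (htime I v)
  have hT : T + P.rounds = T + (P.k + 1) + (P.J + 1) + (K + 1) := by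
    unfold LevelParams.rounds; omega
  rw [hT]
  refine (hf'.iterate_restrict (by simpa using hbp) hnode hadj x (fun _ => none)
    (fun s a w => if a.2 a.1.node = s then
      some (chooseClass a.1.colors P.part P.B
        (a.1.nbrs.filter fun j => a.2 j = a.2 a.1.node).card
        fun i => (a.1.nbrs.filter fun j => w j = some i).card) else w a.1.node)
    ?_ ?_ (K + 1)).of_eq_map
    (fun a => ⟨a.1.node, a.1.nbrs.filter fun j => a.2.2 K j = a.2.2 K a.1.node,
      a.1.nbrs.filter fun j => a.2.2 K j = a.2.2 K a.1.node ∧ a.2.1 j ≤ a.2.1 a.1.node,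
      a.1.colors.filter fun x => some (P.part x) = a.2.2 K a.1.node⟩) ?_
  · intro I v
    rfl
  · intro I s v
    simp only [hnode, LevelState.restrict_node _ (hnode I v)]
    have hfil : ((κ I v).nbrs.filter fun j =>
        (κ I v).restrict (P.time (κ I)) j = P.time (κ I) v).card = P.conflicts (κ I) v := by
      unfold LevelParams.conflicts
      congr 1
      refine Finset.filter_congr fun j hj => by rw [LevelState.restrict_nbr _ hj]
    rw [hfil]
    have hfil' : (fun i => ((κ I v).nbrs.filter fun j =>
        (κ I v).restrict (x I s) j = some i).card) =
        fun i => ((κ I v).nbrs.filter fun j => x I s j = some i).card := by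
      funext i
      congr 1
      refine Finset.filter_congr fun j hj => by rw [LevelState.restrict_nbr _ hj]
    rw [hfil']
    simp only [x]
    rw [sweep]
    rfl
  · intro I v
    simp only [Nat.lt_succ_self, if_true]
    simp only [hnode, LevelState.restrict_node _ (hnode I v), hx]
    unfold LevelParams.next
    congr 1
    · refine Finset.filter_congr fun j hj => ?_
      rw [LevelState.restrict_nbr _ hj, hx, Option.some_inj]
    · refine Finset.filter_congr fun j hj => ?_
      rw [LevelState.restrict_nbr _ hj, LevelState.restrict_nbr _ hj, hx, Option.some_inj]
    · refine Finset.filter_congr fun j hj => ?_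
      rw [Option.some_inj]

end LocallyComputable

/-! ### The recursion over the digits -/

/-- The parameters of level `l` of the `r` levels. -/
noncomputable def levelParams (p r k m J : ℕ) (ε : ℝ) (l : ℕ) : LevelParams where
  p := p
  w := p ^ (r - l - 1)
  θ := 2 + ε / 2
  B := (2 + ε) ^ (r - l - 1)
  k := k
  m := m
  J := J

instance {p r k m J l : ℕ} {ε : ℝ} [h : NeZero p] : NeZero (levelParams p r k m J ε l).p := h

namespace Network

variable {N C : ℕ} (I : Network N C)

open Classical in
/-- The nodes that have to be colored. -/
def Demanding (r : ℕ) (ε : ℝ) (v : Fin N) : Prop :=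
  (2 + ε) ^ r * ((Finset.univ.filter fun j => I.arc v j).card : ℝ) < ((I.colors v).card : ℝ)

open Classical in
/-- The states before the first level, when only the demanding nodes participate. -/
noncomputable def startState (r : ℕ) (ε : ℝ) (v : Fin N) : LevelState N C where
  node := v
  nbrs := if I.Demanding r ε v then
    (Finset.univ.filter fun j => I.Adj v j).filter fun j => I.Demanding r ε j else ∅
  outs := if I.Demanding r ε v then
    (Finset.univ.filter fun j => I.arc v j).filter fun j => I.Demanding r ε j else ∅
  colors := if I.Demanding r ε v then I.colors v else ∅

/-- The states after `l` levels. -/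
noncomputable def levelState [NeZero N] (p r k m J : ℕ) [NeZero p] (ε : ℝ) :
    ℕ → Fin N → LevelState N C
  | 0 => I.startState r ε
  | l + 1 => (levelParams p r k m J ε l).next (levelState p r k m J ε l)

/-- The properties of the states after `l` of `r` levels. -/
structure LevelInvariant (p r : ℕ) (ε : ℝ) (l : ℕ) (κ : Fin N → LevelState N C) : Prop where
  node : ∀ v, (κ v).node = v
  adj : ∀ v, ∀ j ∈ (κ v).nbrs, I.Adj v j
  symm : ∀ v, ∀ j ∈ (κ v).nbrs, v ∈ (κ j).nbrs
  cover : ∀ v, ∀ j ∈ (κ v).nbrs, j ∈ (κ v).outs ∨ v ∈ (κ j).outs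
  colors_subset : ∀ v, (κ v).colors ⊆ I.colors v
  demanding : ∀ v, ∀ x ∈ (κ v).colors, I.Demanding r ε v
  card : ∀ v, I.Demanding r ε v →
    (2 + ε) ^ (r - l) * ((κ v).outs.card : ℝ) < ((κ v).colors.card : ℝ)
  disjoint : ∀ v j, I.Adj v j → j ∉ (κ v).nbrs → ∀ x ∈ (κ v).colors, x ∉ (κ j).colors
  digits : ∀ v, ∀ x ∈ (κ v).colors, ∀ y ∈ (κ v).colors,
    (x : ℕ) / p ^ (r - l) = (y : ℕ) / p ^ (r - l)

theorem not_adj_self (v : Fin N) : ¬ I.Adj v v := fun h =>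
  h.elim (fun h => I.asymm v v h h) fun h => I.asymm v v h h

variable {I} {p r k m J : ℕ} {ε : ℝ}

/-- Discarding undemanding nodes only lowers out-degrees, and their lists become empty, so the lost
edges cannot create conflicts. No digit is fixed yet, as `C ≤ p ^ r`. -/
theorem startState_invariant (hε : 0 < ε) (hp : C ≤ p ^ r) :
    I.LevelInvariant p r ε 0 (I.startState r ε) := by
  classical
  have hnbr : ∀ v j, j ∈ (I.startState r ε v).nbrs ↔
      I.Demanding r ε v ∧ I.Adj v j ∧ I.Demanding r ε j := by
    intro v j
    unfold startState
    by_cases h : I.Demanding r ε v <;> simp [h]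
  have hout : ∀ v j, j ∈ (I.startState r ε v).outs ↔
      I.Demanding r ε v ∧ I.arc v j ∧ I.Demanding r ε j := by
    intro v j
    unfold startState
    by_cases h : I.Demanding r ε v <;> simp [h]
  have hcol : ∀ v x, x ∈ (I.startState r ε v).colors ↔
      I.Demanding r ε v ∧ x ∈ I.colors v := by
    intro v x
    unfold startState
    by_cases h : I.Demanding r ε v <;> simp [h]
  refine ⟨fun v => rfl, fun v j h => ((hnbr v j).1 h).2.1, fun v j h => ?_, fun v j h => ?_,
    fun v x h => ((hcol v x).1 h).2, fun v x h => ((hcol v x).1 h).1, fun v h => ?_,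
    fun v j hadj hj x hx hx' => hj ((hnbr v j).2 ⟨((hcol v x).1 hx).1, hadj, ((hcol j x).1 hx').1⟩),
    fun v x _ y _ => ?_⟩
  · obtain ⟨h1, h2, h3⟩ := (hnbr v j).1 h
    exact (hnbr j v).2 ⟨h3, h2.symm, h1⟩
  · obtain ⟨h1, h2, h3⟩ := (hnbr v j).1 h
    exact h2.imp (fun h => (hout v j).2 ⟨h1, h, h3⟩) fun h => (hout j v).2 ⟨h3, h, h1⟩
  · have h' := h
    unfold Demanding at h'
    have hc : (I.startState r ε v).colors = I.colors v := by
      unfold startState; simp [h]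
    rw [hc, Nat.sub_zero]
    refine lt_of_le_of_lt (mul_le_mul_of_nonneg_left ?_ (by positivity)) h'
    have : (I.startState r ε v).outs.card ≤ (Finset.univ.filter fun j => I.arc v j).card :=
      Finset.card_le_card fun j hj => by simpa using ((hout v j).1 hj).2.1
    exact_mod_cast this
  · rw [Nat.sub_zero, Nat.div_eq_of_lt (x.2.trans_le hp), Nat.div_eq_of_lt (y.2.trans_le hp)]

/-- Conditions on the parameters under which every level works. -/
structure AdmissibleParams (N p k m J : ℕ) (ε : ℝ) : Prop where
  m_ne_zero : m ≠ 0
  le_pow : N ≤ (2 ^ m) ^ 2 ^ (J + 1)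
  pow_lt : J = 0 ∨ (2 ^ m) ^ 2 ^ J < N
  sq_lt : (N : ℝ) ^ 2 < (1 + ε / 4) ^ k
  le_two_pow : 30 * p / ε ≤ 2 ^ m

variable [NeZero N] [NeZero p]

/-- Neighbors separated in this level chose different digits, so their lists become disjoint. Edges
kept are directed to the end that chose first, and both ways in case of a tie, which preserves
`cover`. -/
theorem next_invariant (hP : AdmissibleParams N p k m J ε) (hε : 0 < ε) (hε1 : ε ≤ 1) {l : ℕ}
    (hl : l < r) {κ : Fin N → LevelState N C} (h : I.LevelInvariant p r ε l κ) :
    I.LevelInvariant p r ε (l + 1) ((levelParams p r k m J ε l).next κ) := by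
  classical
  set P := levelParams p r k m J ε l with hPdef
  have hnbr : ∀ v j, j ∈ (P.next κ v).nbrs ↔ j ∈ (κ v).nbrs ∧ P.choice κ j = P.choice κ v :=
    fun v j => Finset.mem_filter
  have hout : ∀ v j, j ∈ (P.next κ v).outs ↔
      j ∈ (κ v).nbrs ∧ P.choice κ j = P.choice κ v ∧ P.time κ j ≤ P.time κ v :=
    fun v j => Finset.mem_filter
  have hcol : ∀ v x, x ∈ (P.next κ v).colors ↔ x ∈ (κ v).colors ∧ P.part x = P.choice κ v :=
    fun v x => Finset.mem_filter
  have hrl : r - l - 1 + 1 = r - l := by omega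
  have hrl' : r - (l + 1) = r - l - 1 := by omega
  refine ⟨fun v => rfl, fun v j hj => h.adj v j ((hnbr v j).1 hj).1, fun v j hj => ?_,
    fun v j hj => ?_, fun v x hx => h.colors_subset v ((hcol v x).1 hx).1,
    fun v x hx => h.demanding v x ((hcol v x).1 hx).1, fun v hv => ?_,
    fun v j hadj hj x hx hx' => ?_, fun v x hx y hy => ?_⟩
  · obtain ⟨h1, h2⟩ := (hnbr v j).1 hj
    exact (hnbr j v).2 ⟨h.symm v j h1, h2.symm⟩
  · obtain ⟨h1, h2⟩ := (hnbr v j).1 hj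
    rcases le_total (P.time κ j) (P.time κ v) with ht | ht
    · exact Or.inl ((hout v j).2 ⟨h1, h2, ht⟩)
    · exact Or.inr ((hout j v).2 ⟨h.symm v j h1, h2.symm, ht⟩)
  · rw [hrl']
    refine LevelParams.lt_card_next_colors (P := P) (κ := κ)
      (fun v hv => I.not_adj_self v (h.adj v v hv)) hP.m_ne_zero hP.le_pow hP.pow_lt hε hε1 rfl
      h.cover ?_ hP.le_two_pow ?_ ?_
    · have : P.θ / 2 = 1 + ε / 4 := by
        simp only [hPdef, levelParams]; ring
      rw [this]
      exact hP.sq_lt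
    · simp only [hPdef, levelParams]; positivity
    · have := h.card v hv
      rw [← hrl, pow_succ] at this
      exact this
  · obtain ⟨h1, h2⟩ := (hcol v x).1 hx
    obtain ⟨h3, h4⟩ := (hcol j x).1 hx'
    by_cases hj' : j ∈ (κ v).nbrs
    · exact hj ((hnbr v j).2 ⟨hj', h4.symm.trans h2⟩)
    · exact h.disjoint v j hadj hj' x h1 h3
  · obtain ⟨h1, h2⟩ := (hcol v x).1 hx
    obtain ⟨h3, h4⟩ := (hcol v y).1 hy
    -- The old invariant gives equal quotients and the common choice gives equal remainders modulo
    -- `p`; together they fix one more digit.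
    have hdiv := h.digits v x h1 y h3
    rw [← hrl, pow_succ, ← Nat.div_div_eq_div_mul, ← Nat.div_div_eq_div_mul] at hdiv
    have hmod : (x : ℕ) / p ^ (r - l - 1) % p = (y : ℕ) / p ^ (r - l - 1) % p :=
      congrArg Fin.val (h2.trans h4.symm)
    rw [hrl', ← Nat.div_add_mod ((x : ℕ) / p ^ (r - l - 1)) p,
      ← Nat.div_add_mod ((y : ℕ) / p ^ (r - l - 1)) p, hdiv, hmod]

theorem levelState_invariant (hP : AdmissibleParams N p k m J ε) (hε : 0 < ε) (hε1 : ε ≤ 1)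
    (hp : C ≤ p ^ r) (l : ℕ) (hl : l ≤ r) :
    I.LevelInvariant p r ε l (I.levelState p r k m J ε l) := by
  induction l with
  | zero => exact startState_invariant hε hp
  | succ l ih => exact next_invariant hP hε hε1 hl (ih (by omega))

end Network

/-! ### Reading off the final colors -/

open Classical in
/-- Some color of the list, if there is one. -/
noncomputable def someColor {C : ℕ} (s : Finset (Fin C)) : Option (Fin C) :=
  if h : s.Nonempty then some h.choose else none

theorem mem_of_someColor_eq {C : ℕ} {s : Finset (Fin C)} {a : Fin C} (h : someColor s = some a) :
    a ∈ s := by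
  unfold someColor at h
  split_ifs at h with hs
  exact Option.some_injective _ h ▸ hs.choose_spec

theorem someColor_ne_none {C : ℕ} {s : Finset (Fin C)} (h : s.Nonempty) : someColor s ≠ none := by
  unfold someColor
  rw [dif_pos h]
  exact Option.some_ne_none _

namespace Network.LevelInvariant

variable {N C p r : ℕ} {ε : ℝ} {I : Network N C} {κ : Fin N → LevelState N C}

theorem someColor_mem {l : ℕ} (h : I.LevelInvariant p r ε l κ) {v : Fin N} {a : Fin C}
    (ha : someColor (κ v).colors = some a) : a ∈ I.colors v :=
  h.colors_subset v (mem_of_someColor_eq ha)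

theorem someColor_ne_none {l : ℕ} (h : I.LevelInvariant p r ε l κ) (hε : 0 < ε) {v : Fin N}
    (hv : I.Demanding r ε v) : someColor (κ v).colors ≠ none := by
  apply _root_.someColor_ne_none
  rw [← Finset.card_pos]
  have h1 := h.card v hv
  have h2 : 0 ≤ (2 + ε) ^ (r - l) * ((κ v).outs.card : ℝ) := by positivity
  exact_mod_cast h2.trans_lt h1

/-- With all digits fixed the list has at most one color, while its size still exceeds the
out-degree, which must therefore be zero. -/
theorem not_mem_outs (h : I.LevelInvariant p r ε r κ) {v : Fin N} (hv : I.Demanding r ε v)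
    (j : Fin N) : j ∉ (κ v).outs := by
  intro hj
  have h1 := h.card v hv
  rw [Nat.sub_self, pow_zero, one_mul] at h1
  have h2 : (κ v).outs.card < (κ v).colors.card := by exact_mod_cast h1
  have h3 : 0 < (κ v).outs.card := Finset.card_pos.2 ⟨j, hj⟩
  have h4 : (κ v).colors.card ≤ 1 := Finset.card_le_one.2 fun x hx y hy => by
    have := h.digits v x hx y hy
    simpa [Fin.ext_iff] using this
  omega

/-- A shared color forces the edge to have survived all levels. One end then has the other as
out-neighbor, although both ends are demanding. -/
theorem someColor_ne (h : I.LevelInvariant p r ε r κ) {u v : Fin N} (hadj : I.Adj u v) :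
    someColor (κ u).colors ≠ someColor (κ v).colors ∨
      (someColor (κ u).colors = none ∧ someColor (κ v).colors = none) := by
  by_cases heq : someColor (κ u).colors = someColor (κ v).colors
  · right
    rcases hc : someColor (κ u).colors with _ | a
    · exact ⟨rfl, heq ▸ hc⟩
    · exfalso
      have hu := mem_of_someColor_eq hc
      have hv := mem_of_someColor_eq (heq ▸ hc)
      have hnbr : v ∈ (κ u).nbrs := by
        by_contra hn
        exact h.disjoint u v hadj hn a hu hv
      rcases h.cover u v hnbr with ho | ho
      · exact h.not_mem_outs (h.demanding u a hu) v ho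
      · exact h.not_mem_outs (h.demanding v a hv) u ho
  · exact Or.inl heq

end Network.LevelInvariant

/-! ### Distributed implementation of the recursion -/

namespace LocallyComputable

variable {N C b : ℕ}

open Classical in
-- The single round lets every node announce whether it is demanding.
theorem startState [NeZero N] (hb : 2 ≤ 2 ^ b) (r : ℕ) (ε : ℝ) :
    LocallyComputable.{u} (N := N) (C := C) b 1 (fun I => I.startState r ε) := by
  have h := (localInput.{u} (N := N) (C := C) (b := b)).exchange (μ := Bool) (by simpa using hb)
    (fun a => decide ((2 + ε) ^ r * (a.2.1.card : ℝ) < (a.2.2.2.card : ℝ)))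
  refine h.of_eq_map (fun a =>
    ⟨a.1.1, if a.2 a.1.1 = true then (a.1.2.1 ∪ a.1.2.2.1).filter fun j => a.2 j = true else ∅,
      if a.2 a.1.1 = true then a.1.2.1.filter fun j => a.2 j = true else ∅,
      if a.2 a.1.1 = true then a.1.2.2.2 else ∅⟩) ?_
  intro I v
  have hself : I.view (fun j => decide ((2 + ε) ^ r * ((Network.localInput I j).2.1.card : ℝ) <
      ((Network.localInput I j).2.2.2.card : ℝ))) v v = true ↔ I.Demanding r ε v := by
    rw [Network.view_self, decide_eq_true_eq]
    rfl
  have hnbr : ∀ j, I.Adj v j → (I.view (fun j => decide ((2 + ε) ^ r *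
      ((Network.localInput I j).2.1.card : ℝ) <
        ((Network.localInput I j).2.2.2.card : ℝ))) v j = true ↔ I.Demanding r ε j) := by
    intro j hj
    rw [Network.view_adj _ _ hj, decide_eq_true_eq]
    rfl
  have hv : (Network.localInput I v).1 = v := rfl
  simp only [hv, hself]
  unfold Network.startState
  congr 1
  · refine if_congr Iff.rfl ?_ rfl
    ext j
    refine Finset.mem_filter.trans (Iff.trans ?_ Finset.mem_filter.symm)
    have hmem : j ∈ (Network.localInput I v).2.1 ∪ (Network.localInput I v).2.2.1 ↔
        j ∈ Finset.univ.filter fun j => I.Adj v j := by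
      have hadj : (j ∈ Finset.univ.filter fun j => I.Adj v j) ↔ I.Adj v j :=
        Finset.mem_filter.trans (and_iff_right (Finset.mem_univ j))
      rw [Finset.mem_union, hadj]
      exact or_congr (Finset.mem_filter.trans (and_iff_right (Finset.mem_univ j)))
        (Finset.mem_filter.trans (and_iff_right (Finset.mem_univ j)))
    rw [hmem]
    exact and_congr_right fun hj => (hnbr j (by simpa using hj)).symm
  · refine if_congr Iff.rfl ?_ rfl
    ext j
    refine Finset.mem_filter.trans (Iff.trans ?_ Finset.mem_filter.symm)
    exact and_congr_right fun hj => (hnbr j (Or.inl (by simpa using hj))).symm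

theorem levelState [NeZero N] {p r k m J : ℕ} [NeZero p] {ε : ℝ} (hb₂ : 2 ≤ 2 ^ b)
    (hbN : N ≤ 2 ^ b) (hbp : p + 1 ≤ 2 ^ b) (hP : Network.AdmissibleParams N p k m J ε)
    (hε : 0 < ε) (hε1 : ε ≤ 1) (hp : C ≤ p ^ r) (l : ℕ) (hl : l ≤ r) :
    LocallyComputable.{u} (N := N) (C := C) b
      (1 + l * ((k + 1) + (J + 1) + ((k + 1) * (2 ^ m) ^ 2 + 1)))
      (fun I => I.levelState p r k m J ε l) := by
  induction l with
  | zero =>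
    simp only [zero_mul, add_zero]
    exact startState hb₂ r ε
  | succ l ih =>
    have hinv := fun I : Network N C =>
      Network.levelState_invariant (I := I) hP hε hε1 hp l (by omega)
    have h := (ih (by omega)).next (levelParams p r k m J ε l) hb₂ hbN hbp
      (fun I => (hinv I).node) (fun I => (hinv I).adj) fun I v =>
        LevelParams.time_lt (fun v hv => I.not_adj_self v ((hinv I).adj v v hv))
          hP.m_ne_zero hP.le_pow hP.pow_lt v
    rw [add_mul, one_mul, ← add_assoc]
    exact h

end LocallyComputable

/-! ### Choice of parameters and round count -/

/-- Take C^(1/r) rounded up; as it is at least 1, rounding at most doubles it. -/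
theorem exists_base {C r : ℕ} (hC : 1 ≤ C) (hr : 1 ≤ r) :
    ∃ p : ℕ, 1 ≤ p ∧ p ≤ C ∧ C ≤ p ^ r ∧
      (p : ℝ) ^ 2 ≤ 4 * (C : ℝ) ^ ((2 : ℝ) / (r : ℝ)) := by
  have hC' : (1 : ℝ) ≤ C := by exact_mod_cast hC
  have hr' : (1 : ℝ) ≤ r := by exact_mod_cast hr
  have hr0 : (r : ℝ) ≠ 0 := by positivity
  set y : ℝ := (C : ℝ) ^ ((1 : ℝ) / r) with hy
  have hy1 : 1 ≤ y := Real.one_le_rpow hC' (by positivity)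
  have hyC : y ≤ C := by
    calc y ≤ (C : ℝ) ^ (1 : ℝ) := Real.rpow_le_rpow_of_exponent_le hC' (by
          rw [div_le_one (by positivity)]; exact hr')
      _ = C := Real.rpow_one _
  have hyr : y ^ r = C := by
    rw [hy, ← Real.rpow_natCast, ← Real.rpow_mul (by positivity), one_div_mul_cancel hr0,
      Real.rpow_one]
  have hy2 : y ^ 2 = (C : ℝ) ^ ((2 : ℝ) / (r : ℝ)) := by
    rw [hy, ← Real.rpow_natCast, ← Real.rpow_mul (by positivity)]
    congr 1
    push_cast
    ring
  refine ⟨⌈y⌉₊, ?_, ?_, ?_, ?_⟩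
  · exact Nat.one_le_iff_ne_zero.2 (Nat.ceil_pos.2 (by linarith)).ne'
  · exact Nat.ceil_le.2 hyC
  · have : (C : ℝ) ≤ (⌈y⌉₊ : ℝ) ^ r := by
      rw [← hyr]
      exact pow_le_pow_left₀ (by linarith) (Nat.le_ceil y) r
    exact_mod_cast this
  · have h1 : (⌈y⌉₊ : ℝ) ≤ 2 * y := by
      have := Nat.ceil_lt_add_one (show 0 ≤ y by linarith)
      linarith
    rw [← hy2]
    have h0 : (0 : ℝ) ≤ ⌈y⌉₊ := Nat.cast_nonneg _
    nlinarith

theorem exists_two_pow_between {x : ℝ} (hx : 1 ≤ x) :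
    ∃ m : ℕ, m ≠ 0 ∧ x ≤ 2 ^ m ∧ (2 : ℝ) ^ m ≤ 2 * x := by
  obtain ⟨n, h1, h2⟩ := exists_nat_pow_near hx (one_lt_two : (1 : ℝ) < 2)
  refine ⟨n + 1, Nat.succ_ne_zero n, h2.le, ?_⟩
  rw [pow_succ]
  linarith

/-- The least sufficient number of square-root steps. Minimality is what keeps the recolored values
below `N`; the crude bound `M` suffices because the color classes dominate the round count. -/
theorem exists_minimal_tower {N Q M : ℕ} (hQ : 2 ≤ Q) (hN : N ≤ 2 ^ M) :
    ∃ J ≤ M, N ≤ Q ^ 2 ^ (J + 1) ∧ (J = 0 ∨ Q ^ 2 ^ J < N) := by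
  classical
  have hM : N ≤ Q ^ 2 ^ (M + 1) := by
    refine hN.trans (le_trans (Nat.pow_le_pow_right (by norm_num) ?_) (Nat.pow_le_pow_left hQ _))
    exact (Nat.lt_two_pow_self.trans_le (Nat.pow_le_pow_right (by norm_num) (Nat.le_succ M))).le
  have hex : ∃ J, N ≤ Q ^ 2 ^ (J + 1) := ⟨M, hM⟩
  refine ⟨Nat.find hex, Nat.find_min' hex hM, Nat.find_spec hex, ?_⟩
  rcases h : Nat.find hex with _ | J
  · exact Or.inl rfl
  · exact Or.inr (not_le.1 (Nat.find_min hex (show J < Nat.find hex by omega)))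

theorem exists_growth_exponent {ε : ℝ} (hε : 0 < ε) (hε1 : ε ≤ 1) {N M : ℕ} (hN : N ≤ 2 ^ M) :
    ∃ k : ℕ, (N : ℝ) ^ 2 < (1 + ε / 4) ^ k ∧ (k : ℝ) ≤ 5 / ε * (2 * M + 1) := by
  refine ⟨⌈4 / ε⌉₊ * (2 * M + 1), ?_, ?_⟩
  · have h1 : (2 : ℝ) ≤ (1 + ε / 4) ^ ⌈4 / ε⌉₊ := by
      have hb := one_add_mul_le_pow (show (-2 : ℝ) ≤ ε / 4 by linarith) ⌈4 / ε⌉₊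
      have hc : 4 / ε ≤ (⌈4 / ε⌉₊ : ℝ) := Nat.le_ceil _
      have hd : 1 ≤ (⌈4 / ε⌉₊ : ℝ) * (ε / 4) := by
        calc (1 : ℝ) = 4 / ε * (ε / 4) := by field_simp
          _ ≤ _ := mul_le_mul_of_nonneg_right hc (by positivity)
      linarith
    have h2 : (N : ℝ) ≤ 2 ^ M := by exact_mod_cast hN
    rw [pow_mul]
    calc (N : ℝ) ^ 2 ≤ (2 ^ M) ^ 2 := pow_le_pow_left₀ (Nat.cast_nonneg _) h2 2
      _ = 2 ^ (2 * M) := by rw [← pow_mul, mul_comm]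
      _ < 2 ^ (2 * M + 1) := pow_lt_pow_right₀ one_lt_two (Nat.lt_succ_self _)
      _ ≤ _ := pow_le_pow_left₀ (by norm_num) h1 _
  · push_cast
    refine mul_le_mul_of_nonneg_right ?_ (by positivity)
    have := Nat.ceil_lt_add_one (show 0 ≤ 4 / ε by positivity)
    have h1 : 1 ≤ 1 / ε := by rw [le_div_iff₀ hε]; linarith
    have h2 : 5 / ε = 4 / ε + 1 / ε := by ring
    linarith

/-- Here `a * t` bounds log₂ N, `z` is C^(2/r) and `q` is the number of defective colors. The
constant is 14400 = 4 · 60², from p² ≤ 4z and Q ≤ 60p/ε. The dominant term is `(k + 1) * q`. -/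
theorem rounds_le {ε a t z r k J q : ℝ} (hε : 0 < ε) (hε1 : ε ≤ 1) (ha : 1 ≤ a) (ht : 1 ≤ t)
    (hz : 1 ≤ z) (hr : 1 ≤ r) (hk : k ≤ 5 / ε * (2 * (a * t) + 1)) (hJ : J ≤ a * t) (hq0 : 0 ≤ q)
    (hq : q ≤ 14400 * z / ε ^ 2) :
    1 + r * ((k + 1) + (J + 1) + ((k + 1) * q + 1)) ≤
      ((10 * a + 6) * 14401 + a + 3) * (r * z / ε ^ 3 * t) := by
  have he : 1 ≤ 1 / ε := by rw [le_div_iff₀ hε]; linarith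
  set d := 1 / ε with hd
  have hk' : k + 1 ≤ (10 * a + 6) * (t * d) := by
    have h1 : 5 / ε = 5 * d := by rw [hd]; ring
    rw [h1] at hk
    have h2 : d ≤ t * d := le_mul_of_one_le_left (by linarith) ht
    have h3 : 5 * d * (2 * (a * t) + 1) = 10 * a * (t * d) + 5 * d := by ring
    nlinarith
  have hq' : q ≤ 14400 * (z * d ^ 2) := by
    refine hq.trans_eq ?_
    rw [hd]; field_simp
  have hz0 : 0 < z := by linarith
  have ht0 : 0 < t := by linarith
  have hd0 : 0 < d := by linarith
  have hU : r * z / ε ^ 3 * t = r * (z * d ^ 3 * t) := by rw [hd]; field_simp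
  rw [hU]
  set U := z * d ^ 3 * t with hUdef
  have hd3 : d ≤ d ^ 3 := le_self_pow₀ he (by norm_num)
  have h1d3 : 1 ≤ d ^ 3 := one_le_pow₀ he
  have htU : t ≤ U := by
    rw [hUdef]
    exact le_mul_of_one_le_left ht0.le (one_le_mul_of_one_le_of_one_le hz h1d3)
  have htdU : t * d ≤ U := by
    have h1 : d ≤ z * d ^ 3 := hd3.trans (le_mul_of_one_le_left (by positivity) hz)
    calc t * d ≤ t * (z * d ^ 3) := mul_le_mul_of_nonneg_left h1 ht0.le
      _ = U := by rw [hUdef]; ring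
  have hkq : (k + 1) * q ≤ (10 * a + 6) * 14400 * U := by
    calc (k + 1) * q ≤ (10 * a + 6) * (t * d) * q := mul_le_mul_of_nonneg_right hk' hq0
      _ ≤ (10 * a + 6) * (t * d) * (14400 * (z * d ^ 2)) :=
          mul_le_mul_of_nonneg_left hq' (by positivity)
      _ = _ := by rw [hUdef]; ring
  have hk2 : k + 1 ≤ (10 * a + 6) * U :=
    hk'.trans (mul_le_mul_of_nonneg_left htdU (by positivity))
  have hJ2 : J ≤ a * U := hJ.trans (mul_le_mul_of_nonneg_left htU (by linarith))
  have hU1 : 1 ≤ U := ht.trans htU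
  have hW : (k + 1) + (J + 1) + ((k + 1) * q + 1) + 1 ≤
      ((10 * a + 6) * 14401 + a + 3) * U := by
    have : ((10 * a + 6) * 14401 + a + 3) * U = (10 * a + 6) * U + (10 * a + 6) * 14400 * U +
      a * U + 3 * U := by ring
    linarith
  calc 1 + r * ((k + 1) + (J + 1) + ((k + 1) * q + 1))
      ≤ r * ((k + 1) + (J + 1) + ((k + 1) * q + 1) + 1) := by linarith
    _ ≤ r * (((10 * a + 6) * 14401 + a + 3) * U) :=
        mul_le_mul_of_nonneg_left hW (by linarith)
    _ = _ := by ring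

theorem pow_add_one_le_two_pow (c : ℕ) {n : ℕ} (hn : 2 ≤ n) :
    n ^ c + 1 ≤ 2 ^ ((2 * c + 1) * Nat.log 2 n) := by
  have hlog : 1 ≤ Nat.log 2 n := Nat.log_pos one_lt_two hn
  have h1 : n ≤ 2 ^ (2 * Nat.log 2 n) :=
    (Nat.lt_pow_succ_log_self one_lt_two n).le.trans (Nat.pow_le_pow_right (by norm_num) (by omega))
  have h2 : n ^ c ≤ 2 ^ (2 * c * Nat.log 2 n) := by
    refine (Nat.pow_le_pow_left h1 c).trans_eq ?_
    rw [← pow_mul]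
    congr 1
    ring
  have h3 : 1 ≤ 2 ^ (2 * c * Nat.log 2 n) := Nat.one_le_two_pow
  calc n ^ c + 1 ≤ 2 ^ (2 * c * Nat.log 2 n) * 2 ^ 1 := by omega
    _ = 2 ^ (2 * c * Nat.log 2 n + 1) := (pow_succ _ _).symm
    _ ≤ _ := Nat.pow_le_pow_right (by norm_num) (by rw [add_mul, one_mul]; omega)

/-! ### Assembling the theorem -/

open Classical in
theorem Network.ofGraph_demanding {V : Type*} [Fintype V] {G : SimpleGraph V} {N C r : ℕ} {ε : ℝ}
    (O : EdgeOrientation G) {ident : V → ℕ} (hinj : Function.Injective ident)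
    (hlt : ∀ v, ident v < N) (L : V → Finset (Fin C)) {v : V}
    (hv : (2 + ε) ^ r * (O.outDegree v : ℝ) < ((L v).card : ℝ)) :
    (Network.ofGraph (N := N) O ident hinj L).Demanding r ε ⟨ident v, hlt v⟩ := by
  have hcard : (Finset.univ.filter fun j =>
      (Network.ofGraph (N := N) O ident hinj L).arc ⟨ident v, hlt v⟩ j) =
      (O.outNeighbors v).image fun u => (⟨ident u, hlt u⟩ : Fin N) := by
    ext j
    simp only [Finset.mem_filter, Finset.mem_univ, true_and, Finset.mem_image,
      EdgeOrientation.outNeighbors]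
    constructor
    · rintro ⟨v', u, hv', hu, h⟩
      obtain rfl := hinj hv'
      exact ⟨u, h, Fin.ext hu⟩
    · rintro ⟨u, h, rfl⟩
      exact (Network.ofGraph_arc O hinj hlt L v u).2 h
  unfold Network.Demanding
  rw [hcard, Finset.card_image_of_injective _ fun u u' h => hinj (congrArg Fin.val h),
    Network.ofGraph_colors]
  exact hv

theorem theorem1 (c : ℕ) :
    ∃ K₁ K₂ : ℝ, ∀ (n Δ C r : ℕ) (ε : ℝ), 1 ≤ r → 0 < ε → ε ≤ 1 →
      ∃ (A : DistributedAlgorithm (ListColoringInput C) (Option (Fin C))) (T : ℕ),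
        (T : ℝ) ≤ K₁ * ((r : ℝ) * (C : ℝ) ^ ((2 : ℝ) / (r : ℝ)) / ε ^ 3 * Real.logb 2 (n : ℝ)) ∧
        ∀ (V : Type*) [Fintype V] (G : SimpleGraph V) [DecidableRel G.Adj]
          (O : EdgeOrientation G) (ident : V → ℕ) (L : V → Finset (Fin C)),
          Fintype.card V = n → G.maxDegree = Δ →
          Function.Injective ident → (∀ v, ident v ≤ n ^ c) →
          (∀ t < T, ∀ u v, G.Adj u v →
            ((A.message G ident (listColoringInput O ident L) t u v).length : ℝ) ≤
              K₂ * (Real.logb 2 (n : ℝ) + Real.logb 2 (C : ℝ))) ∧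
          IsProperPartialListColoring G L
            (A.outputAfter G ident (listColoringInput O ident L) T) ∧
          ∀ v, (2 + ε) ^ r * (O.outDegree v : ℝ) < ((L v).card : ℝ) →
            A.outputAfter G ident (listColoringInput O ident L) T v ≠ none := by
  -- The first constant is that of `rounds_le` with a = 2c+1, since n^c + 1 ≤ 2^((2c+1)⌊log₂ n⌋).
  refine ⟨(10 * (2 * c + 1) + 6) * 14401 + (2 * c + 1) + 3, 2 * c + 3, ?_⟩
  intro n Δ C r ε hr hε hε1
  by_cases hdeg : 2 ≤ n ∧ 1 ≤ C
  · obtain ⟨hn, hC⟩ := hdeg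
    have hlog : 1 ≤ Nat.log 2 n := Nat.log_pos one_lt_two hn
    obtain ⟨p, hp1, hpC, hCp, hp2⟩ := exists_base hC hr
    have hp1' : (1 : ℝ) ≤ p := by exact_mod_cast hp1
    obtain ⟨m, hm0, hm1, hm2⟩ := exists_two_pow_between (x := 30 * p / ε) (by
      rw [le_div_iff₀ hε]; linarith)
    have hN := pow_add_one_le_two_pow c hn
    obtain ⟨J, hJ, hJ1, hJ2⟩ := exists_minimal_tower
      (show 2 ≤ 2 ^ m from Nat.le_self_pow hm0 2) hN
    obtain ⟨k, hk1, hk2⟩ := exists_growth_exponent hε hε1 hN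
    have : NeZero p := ⟨by omega⟩
    have hP : Network.AdmissibleParams (n ^ c + 1) p k m J ε := ⟨hm0, hJ1, hJ2, hk1, hm1⟩
    -- This length must hold a flag, a color below n^c + 1, or an optional digit, where p + 1 ≤
    -- 2^(⌊log₂ C⌋+1); the additional bit is paid for by ⌊log₂ n⌋ ≥ 1.
    set b := (2 * c + 3) * (Nat.log 2 n + Nat.log 2 C) with hb
    have hb₂ : 2 ≤ 2 ^ b := Nat.le_self_pow (by rw [hb]; positivity) 2
    have hbN : n ^ c + 1 ≤ 2 ^ b := by
      refine hN.trans (Nat.pow_le_pow_right (by norm_num) ?_)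
      exact Nat.mul_le_mul (by omega) (by omega)
    have hbp : p + 1 ≤ 2 ^ b := by
      have h1 : p + 1 ≤ 2 ^ (Nat.log 2 C + 1) :=
        (Nat.succ_le_succ hpC).trans (Nat.lt_pow_succ_log_self one_lt_two C)
      refine h1.trans (Nat.pow_le_pow_right (by norm_num) ?_)
      rw [hb]
      nlinarith
    obtain ⟨A, hA⟩ := (LocallyComputable.levelState hb₂ hbN hbp hP hε hε1 hCp r le_rfl).map
      fun st => someColor st.colors
    refine ⟨A, 1 + r * ((k + 1) + (J + 1) + ((k + 1) * (2 ^ m) ^ 2 + 1)), ?_, ?_⟩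
    · have hz : (1 : ℝ) ≤ (C : ℝ) ^ ((2 : ℝ) / (r : ℝ)) :=
        Real.one_le_rpow (by exact_mod_cast hC) (by positivity)
      have hq : ((2 : ℝ) ^ m) ^ 2 ≤ 14400 * (C : ℝ) ^ ((2 : ℝ) / (r : ℝ)) / ε ^ 2 := by
        calc ((2 : ℝ) ^ m) ^ 2 ≤ (2 * (30 * p / ε)) ^ 2 := pow_le_pow_left₀ (by positivity) hm2 2
          _ = 3600 * (p : ℝ) ^ 2 / ε ^ 2 := by field_simp; ring
          _ ≤ _ := by
            refine div_le_div_of_nonneg_right ?_ (by positivity)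
            linarith
      have hrounds := rounds_le (a := 2 * c + 1) (t := Nat.log 2 n) (r := r) (k := k) (J := J)
        hε hε1 (by linarith [(Nat.cast_nonneg c : (0 : ℝ) ≤ c)]) (by exact_mod_cast hlog) hz
        (by exact_mod_cast hr) (by exact_mod_cast hk2) (by exact_mod_cast hJ) (by positivity) hq
      push_cast
      refine hrounds.trans ?_
      refine mul_le_mul_of_nonneg_left (mul_le_mul_of_nonneg_left ?_ (by positivity))
        (by positivity)
      exact Real.natLog_le_logb n 2
    · intro V _ G _ O ident L _ _ hinj hident
      have hlt : ∀ v, ident v < n ^ c + 1 := fun v => Nat.lt_succ_of_le (hident v)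
      obtain ⟨hmsg, hout⟩ := hA V G O ident hinj hlt L
      have hinv := Network.levelState_invariant (I := Network.ofGraph O ident hinj L)
        hP hε hε1 hCp r le_rfl
      refine ⟨fun t ht u v _ => ?_, ⟨fun v a ha => ?_, fun u v huv => ?_⟩, fun v hv => ?_⟩
      · have h1 : ((A.message G ident (listColoringInput O ident L) t u v).length : ℝ) ≤ b := by
          exact_mod_cast hmsg t ht u v
        refine h1.trans ?_
        rw [hb]
        push_cast
        exact mul_le_mul_of_nonneg_left
          (add_le_add (Real.natLog_le_logb n 2) (Real.natLog_le_logb C 2)) (by positivity)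
      · rw [hout] at ha
        have := hinv.someColor_mem ha
        rwa [Network.ofGraph_colors] at this
      · rw [hout, hout]
        exact hinv.someColor_ne ((Network.ofGraph_adj O hinj hlt L u v).2 huv)
      · rw [hout]
        exact hinv.someColor_ne_none hε (Network.ofGraph_demanding O hinj hlt L hv)
  · refine ⟨⟨Finset (Fin C), ListColoringInput.colors, fun _ _ => [], fun s _ => s, someColor⟩, 0,
      ?_, ?_⟩
    · have : 0 ≤ Real.logb 2 (n : ℝ) := by
        rcases Nat.eq_zero_or_pos n with rfl | hn
        · simp
        · exact Real.logb_nonneg one_lt_two (by exact_mod_cast hn)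
      push_cast
      positivity
    · intro V _ G _ O ident L hcard _ _ _
      refine ⟨fun t ht => absurd ht (Nat.not_lt_zero t),
        ⟨fun v a ha => mem_of_someColor_eq ha, fun u v huv => ?_⟩, fun v hv => ?_⟩
      · rcases not_and_or.1 hdeg with hn | hC
        · have : Fintype.card V ≤ 1 := by omega
          exact absurd (Fintype.card_le_one_iff.1 this u v) huv.ne
        · obtain rfl : C = 0 := by omega
          exact Or.inr ⟨Subsingleton.elim _ _, Subsingleton.elim _ _⟩
      · apply someColor_ne_none
        rw [← Finset.card_pos]
        have h : 0 ≤ (2 + ε) ^ r * (O.outDegree v : ℝ) := by positivity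
        exact_mod_cast h.trans_lt hv
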